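/- **Setting.** For a totally ordered abelian group $(\Gamma,\cdot,\preccurlyeq)$ let $\mathbb{K}=\mathbb{R}((\Gamma))$ be the field of generalized series $a=\sum_{\alpha}a_\alpha\alpha$ with real coefficients and anti-well-ordered support in $\Gamma$. Write $\mathrm{LM}(a)=\max(\mathrm{Supp}\,a)$ for the leading monomial of $a\neq 0$; order $\mathbb{K}$ by the sign of the leading coefficient; write $a\preccurlyeq b$ (resp. $a\prec b$, $a\asymp b$) if $\mathrm{LM}(a)\preccurlyeq\mathrm{LM}(b)$ (resp. $\prec$, $=$), and put $0\prec b$ for $b\ne 0$. Let $\mathbb{K}^{\succ 1}=\mathbb{R}((\Gamma^{\succ 1}))$ be the additive group of series all of whose monomials are $\succ 1$. A *pre-logarithmic section* is an embedding of ordered groups $l:(\Gamma,\cdot,\preccurlyeq)\to(\mathbb{K}^{\succ 1},+,\le)$; it induces the pre-logarithm $l(r\alpha(1+\varepsilon))=\log r+l(\alpha)+\sum_{n\ge1}(-1)^{n-1}\varepsilon^n/n$ on $\mathbb{K}^{>0}$ ($r\in\mathbb{R}_{>0}$, $\alpha\in\Gamma$, $\varepsilon\prec1$), and $(\mathbb{K},l)$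 is called a *pre-logarithmic series field*. It satisfies (GA) if $l(\alpha)\prec\alpha$ for all $\alpha\in\Gamma$ with $\alpha\succ 1$. **Exponential closure.** Let $\Gamma^\sharp=\{e^a: a\in\mathbb{K}^{\succ1}\}$ be a multiplicative copy of the ordered group $\mathbb{K}^{\succ 1}$, in which $\alpha\in\Gamma$ is identified with $e^{l(\alpha)}$; let $\mathbb{K}^\sharp=\mathbb{R}((\Gamma^\sharp))\supseteq\mathbb{K}$ and $l^\sharp(e^a)=a$. Then $(\mathbb{K}^\sharp,l^\sharp)$ is again a pre-logarithmic series field. Iterating gives $(\mathbb{K}^{\sharp n},l^{\sharp n})=(\mathbb{R}((\Gamma^{\sharp n})),l^{\sharp n})$, $n\in\mathbb{N}$. Put $\Gamma^{\mathrm{EL}}=\bigcup_n\Gamma^{\sharp n}$, $\mathbb{K}^{\mathrm{EL}}=\bigcup_n\mathbb{K}^{\sharp n}\subseteq\mathbb{R}((\Gamma^{\mathrm{EL}}))$ and $\log=\bigcup_n l^{\sharp n}$ on $(\mathbb{K}^{\mathrm{EL}})^{>0}$. **Derivations.** Let $F$ be $\mathbb{K}$ with its pre-logarithm $l$, or $\mathbb{K}^{\mathrm{EL}}$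 with $\log$. A derivation $a\mapsto a'$ of the field $F$ is * *strongly linear* if for every $a=\sum_\alpha a_\alpha\alpha$ in $F$ the family $(a_\alpha\alpha')_{\alpha\in\mathrm{Supp}\,a}$ is summable (the union of the supports is anti-well-ordered, and each monomial lies in only finitely many of them) with sum $a'$; * *log-compatible* if the derivative of the logarithm of $a$ is $a'/a$ for every $a>0$ in $F$; * *of Hardy type* if (HD1) its field of constants is $\mathbb{R}$; (HD2) for all nonzero $a,b\not\asymp1$ one has $a\preccurlyeq b\Leftrightarrow a'\preccurlyeq b'$; (HD3) for all nonzero $a,b$ with $|a|\succ|b|\succ1$, where $|a|=\max(\mathrm{LM}(a),\mathrm{LM}(a)^{-1})$, one has $a'/a\succcurlyeq b'/b$, and moreover $a'/a\asymp b'/b$ if and only if $a$ and $b$ are comparable, i.e. $\mathrm{LM}(a)$ and $\mathrm{LM}(b)$ lie in the same archimedean class (equivalently, have the same leading fundamental monomial). **Theorem.** Let $(\mathbb{K},l)$ be a pre-logarithmic series field satisfying (GA), and let $d$ be a strongly linear and log-compatible derivation on $\mathbb{K}$. Then $d$ extends to a strongly linear and log-compatible derivation on $\mathbb{K}^{\mathrm{EL}}$,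 and this extension is unique. Moreover, if $d$ is of Hardy type, then so is its extension to $\mathbb{K}^{\mathrm{EL}}$. -/

import Mathlib

open HahnSeries OrderDual

universe u v

set_option linter.unusedSectionVars false

namespace ELSeries

section Series

variable {Γ : Type u} [AddCommGroup Γ] [LinearOrder Γ] [IsOrderedAddMonoid Γ]
variable {Γ' : Type v} [AddCommGroup Γ'] [LinearOrder Γ'] [IsOrderedAddMonoid Γ']

/-- The generalized series field `ℝ((Γ))` over a totally ordered abelian group of monomials `Γ`.
The group `Γ` is written additively: `g : Γ` stands for the monomial `mon g`, with
`mon (g + h) = mon g * mon h` and `mon g ≺ mon h ↔ g < h`. Supports are anti-well-ordered in `Γ`,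
that is, well-ordered in the order dual `Γᵒᵈ`. -/
abbrev Series (Γ : Type u) [AddCommGroup Γ] [LinearOrder Γ] [IsOrderedAddMonoid Γ] : Type u :=
  HahnSeries Γᵒᵈ ℝ

/-- The monomial `g`, as a series. -/
noncomputable def mon (g : Γ) : Series Γ := single (toDual g) 1

/-- The leading monomial `LM a = max (Supp a)` of a nonzero series (for `a = 0` it is a junk
value that is never used). -/
noncomputable def LM (a : Series Γ) : Γ := ofDual a.order

/-- The dominance relation `a ≼ b`, i.e. `LM a ≼ LM b`, where `0 ≼ b` for all `b`
and `a ≼ 0` only for `a = 0`. -/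
def Dom (a b : Series Γ) : Prop := b.orderTop ≤ a.orderTop

/-- The relation `a ≺ b`. -/
def SDom (a b : Series Γ) : Prop := b.orderTop < a.orderTop

/-- The relation `a ≍ b`, i.e. `LM a = LM b`. -/
def Asymp (a b : Series Γ) : Prop := a.orderTop = b.orderTop

/-- `a > 0` in the ordered field of series: the leading coefficient is positive. -/
def Pos (a : Series Γ) : Prop := 0 < a.leadingCoeff

/-- The ordered additive group `ℝ((Γ^{≻ 1}))` of purely infinite series: every monomial of the
support is `≻ 1`. Here `Lex` carries the usual ordering of series, `a < b ↔ LC (b - a) > 0`. -/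
def purelyInfinite (Γ : Type u) [AddCommGroup Γ] [LinearOrder Γ] [IsOrderedAddMonoid Γ] :
    AddSubgroup (Lex (Series Γ)) where
  carrier := {a | ∀ g : Γ, (ofLex a).coeff (toDual g) ≠ 0 → 0 < g}
  zero_mem' := fun g h => absurd (by simp) h
  add_mem' := by
    intro a b ha hb g h
    by_cases h1 : (ofLex a).coeff (toDual g) = 0
    · refine hb g fun h2 => h ?_
      simp [h1, h2]
    · exact ha g h1
  neg_mem' := by
    intro a ha g h
    exact ha g fun h1 => h (by simp [h1])

/-- A strictly increasing homomorphism of groups of monomials, as an embedding of dual orders. -/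
def dualHom (f : Γ →+ Γ') : Γᵒᵈ →+ Γ'ᵒᵈ where
  toFun x := toDual (f (ofDual x))
  map_zero' := by simp
  map_add' x y := by simp

theorem dualHom_injective (f : Γ →+ Γ') (hf : StrictMono f) : Function.Injective (dualHom f) :=
  fun _ _ h => hf.injective h

theorem dualHom_le_iff (f : Γ →+ Γ') (hf : StrictMono f) (x y : Γᵒᵈ) :
    dualHom f x ≤ dualHom f y ↔ x ≤ y :=
  hf.le_iff_le (a := ofDual y) (b := ofDual x)

/-- The embedding of fields `ℝ((Γ)) → ℝ((Γ'))`, `∑ a_α α ↦ ∑ a_α f(α)`, induced by an embedding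
of ordered groups `f : Γ → Γ'`. -/
noncomputable def map (f : Γ →+ Γ') (hf : StrictMono f) : Series Γ →+* Series Γ' :=
  embDomainRingHom (dualHom f) (dualHom_injective f hf) (dualHom_le_iff f hf)

/-- The logarithm on 1-units: `l₁(1 + ε) = ∑_{n ≥ 1} (-1)^{n-1} ε^n / n` for `ε ≺ 1`, as a function
of `ε`. -/
noncomputable def log1p (ε : Series Γ) : Series Γ := (PowerSeries.log ℝ).heval ε

theorem map_coeff (f : Γ →+ Γ') (hf : StrictMono f) (a : Series Γ) (g : Γ) :
    (map f hf a).coeff (toDual (f g)) = a.coeff (toDual g) :=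
  embDomain_mk_coeff (f := dualHom f) (dualHom_injective f hf) (dualHom_le_iff f hf)

theorem map_coeff_of_notMem (f : Γ →+ Γ') (hf : StrictMono f) (a : Series Γ) (g : Γ')
    (hg : g ∉ Set.range f) : (map f hf a).coeff (toDual g) = 0 := by
  refine embDomain_of_notMem_range ?_
  rintro ⟨x, hx⟩
  exact hg ⟨ofDual x, hx⟩

/-- The embedding `map f` restricted to purely infinite series. -/
noncomputable def mapInf (f : Γ →+ Γ') (hf : StrictMono f) :
    purelyInfinite Γ →+ purelyInfinite Γ' where
  toFun a := ⟨toLex (map f hf (ofLex a.1)), by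
    intro g hg
    by_cases h : g ∈ Set.range f
    · obtain ⟨x, rfl⟩ := h
      rw [ofLex_toLex, map_coeff] at hg
      have := hf (a.2 x hg)
      rwa [map_zero] at this
    · exact absurd (map_coeff_of_notMem f hf _ g h) hg⟩
  map_zero' := by
    apply Subtype.ext
    exact map_zero (map f hf)
  map_add' a b := by
    apply Subtype.ext
    exact map_add (map f hf) _ _

theorem mapInf_strictMono (f : Γ →+ Γ') (hf : StrictMono f) : StrictMono (mapInf f hf) := by
  intro a b h
  exact (embDomainOrderEmbedding (R := ℝ)
    (⟨⟨dualHom f, dualHom_injective f hf⟩, dualHom_le_iff f hf _ _⟩ :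
      Γᵒᵈ ↪o Γ'ᵒᵈ)).strictMono h

theorem map_eq_self (f : Γ →+ Γ) (hf : StrictMono f) (h : ∀ x, f x = x) (a : Series Γ) :
    map f hf a = a := by
  ext g
  have := map_coeff f hf a (ofDual g)
  rwa [h] at this

theorem map_map {Γ'' : Type*} [AddCommGroup Γ''] [LinearOrder Γ''] [IsOrderedAddMonoid Γ'']
    (f : Γ →+ Γ') (hf : StrictMono f) (g : Γ' →+ Γ'') (hg : StrictMono g)
    (h : Γ →+ Γ'') (hh : StrictMono h) (hcomp : ∀ x, h x = g (f x)) (a : Series Γ) :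
    map g hg (map f hf a) = map h hh a := by
  ext z
  change _ = (map h hh a).coeff (toDual (ofDual z))
  by_cases hz : ofDual z ∈ Set.range h
  · obtain ⟨x, hx⟩ := hz
    obtain rfl : z = toDual (h x) := hx.symm
    rw [ofDual_toDual, map_coeff, hcomp, map_coeff, map_coeff]
  · rw [map_coeff_of_notMem h hh a _ hz]
    by_cases hz' : ofDual z ∈ Set.range g
    · obtain ⟨y, hy⟩ := hz'
      obtain rfl : z = toDual (g y) := hy.symm
      rw [map_coeff]
      refine map_coeff_of_notMem f hf a y ?_
      rintro ⟨x, rfl⟩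
      exact hz ⟨x, hcomp x⟩
    · exact map_coeff_of_notMem g hg _ _ hz'

theorem map_orderTop (f : Γ →+ Γ') (hf : StrictMono f) (a : Series Γ) :
    (map f hf a).orderTop = WithTop.map (dualHom f) a.orderTop :=
  orderTop_embDomain

theorem map_leadingCoeff (f : Γ →+ Γ') (hf : StrictMono f) (a : Series Γ) :
    (map f hf a).leadingCoeff = a.leadingCoeff := by
  rcases eq_or_ne a 0 with rfl | ha
  · simp
  · have h1 : (map f hf a) ≠ 0 := by simpa using ha
    have h2 := map_orderTop f hf a
    rw [orderTop_of_ne_zero h1, orderTop_of_ne_zero ha] at h2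
    rw [leadingCoeff_of_ne_zero h1, leadingCoeff_of_ne_zero ha]
    simp only [orderTop_of_ne_zero h1, orderTop_of_ne_zero ha, WithTop.untop_coe]
    rw [WithTop.coe_inj.1 h2]
    exact map_coeff f hf a _

theorem map_order (f : Γ →+ Γ') (hf : StrictMono f) (a : Series Γ) :
    (map f hf a).order = dualHom f a.order := by
  rcases eq_or_ne a 0 with rfl | ha
  · simp
  · have h1 : (map f hf a) ≠ 0 := by simpa using ha
    have h2 := map_orderTop f hf a
    rw [← order_eq_orderTop_of_ne_zero h1, ← order_eq_orderTop_of_ne_zero ha] at h2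
    exact WithTop.coe_inj.1 h2

theorem map_single (f : Γ →+ Γ') (hf : StrictMono f) (g : Γᵒᵈ) (r : ℝ) :
    map f hf (single g r) = single (dualHom f g) r :=
  embDomain_single

theorem map_log1p (f : Γ →+ Γ') (hf : StrictMono f) (ε : Series Γ) :
    map f hf (log1p ε) = log1p (map f hf ε) := by
  have hpos : 0 < (map f hf ε).orderTop ↔ 0 < ε.orderTop := by
    rw [map_orderTop]
    cases ε.orderTop with
    | top => simp
    | coe x =>
      simp only [WithTop.map_coe, ← WithTop.coe_zero, WithTop.coe_lt_coe]
      rw [← map_zero (dualHom f)]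
      exact hf.lt_iff_lt
  have hfam (p : PowerSeries ℝ) (n : ℕ) :
      SummableFamily.powerSeriesFamily (map f hf ε) p n =
        map f hf (SummableFamily.powerSeriesFamily ε p n) := by
    have hC (r : ℝ) (x : Series Γ) : map f hf (r • x) = r • map f hf x := embDomain_smul _ _ _
    by_cases h : 0 < ε.orderTop
    · simp [h, hpos.2 h, hC]
    · simp only [SummableFamily.smulFamily_toFun, SummableFamily.powers_toFun, h,
        mt hpos.1 h, hC, if_false]
      rw [map_pow, map_zero]
  ext g
  unfold log1p
  rw [PowerSeries.coeff_heval]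
  simp only [SummableFamily.coeff_apply, hfam]
  by_cases h : ofDual g ∈ Set.range f
  · obtain ⟨x, hx⟩ := h
    obtain rfl : g = toDual (f x) := hx.symm
    simp only [map_coeff]
    rw [PowerSeries.coeff_heval]
    rfl
  · have h0 (a : Series Γ) : (map f hf a).coeff g = 0 := map_coeff_of_notMem f hf a (ofDual g) h
    simp [h0]

end Series

/-- A pre-logarithmic series field `(ℝ((Γ)), l)`: a totally ordered abelian group `Γ` of monomials
and a pre-logarithmic section, i.e. an embedding of ordered groups
`l : (Γ, ·, ≼) → (ℝ((Γ^{≻ 1})), +, ≤)`. -/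
structure PreLogField : Type (u + 1) where
  /-- the group of monomials, written additively -/
  Γ : Type u
  [addCommGroup : AddCommGroup Γ]
  [linearOrder : LinearOrder Γ]
  [isOrderedAddMonoid : IsOrderedAddMonoid Γ]
  /-- the pre-logarithmic section -/
  l : Γ →+ purelyInfinite Γ
  strictMono : StrictMono l

attribute [instance] PreLogField.addCommGroup PreLogField.linearOrder
  PreLogField.isOrderedAddMonoid

namespace PreLogField

/-- The generalized series field `ℝ((Γ))`. -/
abbrev K (P : PreLogField.{u}) : Type u := Series P.Γ

/-- The pre-logarithmic section, with values in `ℝ((Γ))`. -/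
def sec (P : PreLogField.{u}) (g : P.Γ) : P.K := ofLex (P.l g).1

/-- The pre-logarithm induced by the section:
`l(r α (1 + ε)) = log r + l(α) + l₁(1 + ε)` for `r > 0` real, `α` a monomial and `ε ≺ 1`.
(Only the values at series `a > 0` are meaningful.) -/
noncomputable def log (P : PreLogField.{u}) (a : P.K) : P.K :=
  C (Real.log a.leadingCoeff) + P.sec (LM a) +
    log1p (a * (C a.leadingCoeff * mon (LM a))⁻¹ - 1)

theorem map_log (P Q : PreLogField.{u}) (f : P.Γ →+ Q.Γ) (hf : StrictMono f)
    (h : ∀ x, Q.sec (f x) = map f hf (P.sec x)) (a : P.K) :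
    Q.log (map f hf a) = map f hf (P.log a) := by
  have hLM : LM (map f hf a) = f (LM a) := map_order f hf a
  have hmon (g : P.Γ) : map f hf (mon g) = mon (f g) := map_single f hf _ _
  have hC (r : ℝ) : map f hf (C r) = C r := embDomainRingHom_C
  simp only [log, map_leadingCoeff, hLM, h, map_add, map_log1p, hC, map_sub, map_mul, map_inv₀,
    map_one, hmon]

/-- The growth axiom scheme (GA): `l(α) ≺ α` for all monomials `α ≻ 1`. -/
def GrowthAxiom (P : PreLogField.{u}) : Prop := ∀ g : P.Γ, 0 < g → SDom (P.sec g) (mon g)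

/-- The extension `(K^♯, l^♯)` of `(K, l)`. Its group of monomials `Γ^♯` is the multiplicative copy
`{e^a : a ∈ K^{≻ 1}}` of the ordered group of purely infinite series of `K` (since our groups of
monomials are written additively, it is this group itself); `Γ` is embedded in `Γ^♯` by
`α ↦ e^{l(α)}`, that is, by `l`, so that `Γ^♯` is `Γ` together with the new monomials `e^a`,
`a ∈ K^{≻ 1} \ l(Γ)`, with `α · e^a = e^{l(α) + a}`; and `l^♯ (e^a) = a`, seen in `K^♯` through the embedding
`K → K^♯` induced by `Γ → Γ^♯`. -/
noncomputable def sharp (P : PreLogField.{u}) : PreLogField.{u} where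
  Γ := purelyInfinite P.Γ
  l := mapInf P.l P.strictMono
  strictMono := mapInf_strictMono _ _

/-- The `n`-th extension `(K^{♯n}, l^{♯n})`. -/
noncomputable def stage (P : PreLogField.{u}) : ℕ → PreLogField.{u}
  | 0 => P
  | n + 1 => (P.stage n).sharp

/-- The embedding of ordered groups `Γ^{♯n} → Γ^{♯(n+1)}`, `α ↦ e^{l^{♯n}(α)}`. -/
noncomputable def step (P : PreLogField.{u}) (n : ℕ) : (P.stage n).Γ →+ (P.stage (n + 1)).Γ :=
  (P.stage n).l

theorem step_strictMono (P : PreLogField.{u}) (n : ℕ) : StrictMono (P.step n) :=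
  (P.stage n).strictMono

/-- The embedding of ordered groups `Γ^{♯m} → Γ^{♯n}` for `m ≤ n`, obtained by composing the
embeddings `Γ^{♯k} → Γ^{♯(k+1)}`. -/
noncomputable def trans (P : PreLogField.{u}) (m n : ℕ) (h : m ≤ n) :
    (P.stage m).Γ →+ (P.stage n).Γ :=
  Nat.leRecOn (C := fun k => (P.stage m).Γ →+ (P.stage k).Γ) h
    (fun {k} f => (P.step k).comp f) (AddMonoidHom.id _)

theorem trans_self (P : PreLogField.{u}) (m : ℕ) (x : (P.stage m).Γ) :
    P.trans m m le_rfl x = x := by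
  unfold trans
  rw [Nat.leRecOn_self]
  rfl

theorem trans_succ (P : PreLogField.{u}) (m n : ℕ) (h : m ≤ n) (x : (P.stage m).Γ) :
    P.trans m (n + 1) (Nat.le_succ_of_le h) x = P.step n (P.trans m n h x) := by
  unfold trans
  rw [Nat.leRecOn_succ h]
  rfl

theorem trans_strictMono (P : PreLogField.{u}) (m n : ℕ) (h : m ≤ n) :
    StrictMono (P.trans m n h) := by
  induction n, h using Nat.le_induction with
  | base => intro x y hxy; simpa only [trans_self] using hxy
  | succ n h ih =>
    intro x y hxy
    rw [trans_succ P m n h, trans_succ P m n h]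
    exact P.step_strictMono n (ih hxy)

theorem trans_trans (P : PreLogField.{u}) (m n k : ℕ) (h : m ≤ n) (h' : n ≤ k)
    (x : (P.stage m).Γ) : P.trans n k h' (P.trans m n h x) = P.trans m k (h.trans h') x := by
  induction k, h' using Nat.le_induction with
  | base => rw [trans_self]
  | succ k h' ih => rw [trans_succ P n k h', trans_succ P m k (h.trans h'), ih]

instance (P : PreLogField.{u}) :
    DirectedSystem (fun n => (P.stage n).Γ) (fun m n h => P.trans m n h) where
  map_self _ x := P.trans_self _ x
  map_map _ _ _ h h' x := P.trans_trans _ _ _ h h' x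

/-- The group of monomials `Γ^EL = ⋃ₙ Γ^{♯n}`, as a direct limit. -/
def ΓEL (P : PreLogField.{u}) : Type u :=
  DirectLimit (fun n => (P.stage n).Γ) (fun m n h => P.trans m n h)

noncomputable instance (P : PreLogField.{u}) : AddCommGroup P.ΓEL :=
  inferInstanceAs
    (AddCommGroup (DirectLimit (fun n => (P.stage n).Γ) (fun m n h => P.trans m n h)))

/-- The embedding `Γ^{♯n} → Γ^EL`. -/
noncomputable def ofStage (P : PreLogField.{u}) (n : ℕ) : (P.stage n).Γ →+ P.ΓEL where
  toFun x := (⟦⟨n, x⟩⟧ : DirectLimit (fun n => (P.stage n).Γ) (fun m n h => P.trans m n h))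
  map_zero' := (DirectLimit.zero_def n).symm
  map_add' x y := (DirectLimit.add_def (f := fun m n h => P.trans m n h) n x y).symm

theorem ofStage_trans (P : PreLogField.{u}) (m n : ℕ) (h : m ≤ n) (x : (P.stage m).Γ) :
    P.ofStage n (P.trans m n h x) = P.ofStage m x :=
  (DirectLimit.eq_of_le (F := fun n => (P.stage n).Γ) (f := fun m n h => P.trans m n h)
    ⟨m, x⟩ n h).symm

theorem ofStage_injective (P : PreLogField.{u}) (n : ℕ) : Function.Injective (P.ofStage n) :=
  DirectLimit.mk_injective (fun m n h => P.trans m n h)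
    (fun m n h => (P.trans_strictMono m n h).injective) n

theorem exists_ofStage₂ (P : PreLogField.{u}) (x y : P.ΓEL) :
    ∃ n a b, x = P.ofStage n a ∧ y = P.ofStage n b :=
  DirectLimit.exists_eq_mk₂ (fun m n h => P.trans m n h) x y

theorem exists_ofStage₃ (P : PreLogField.{u}) (x y z : P.ΓEL) :
    ∃ n a b c, x = P.ofStage n a ∧ y = P.ofStage n b ∧ z = P.ofStage n c :=
  DirectLimit.exists_eq_mk₃ (fun m n h => P.trans m n h) x y z

/-- The ordering of `Γ^EL`: the union of the orderings of the `Γ^{♯n}`. -/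
instance (P : PreLogField.{u}) : LE P.ΓEL where
  le x y := ∃ n a b, x = P.ofStage n a ∧ y = P.ofStage n b ∧ a ≤ b

theorem ofStage_le (P : PreLogField.{u}) (n : ℕ) (a b : (P.stage n).Γ) :
    P.ofStage n a ≤ P.ofStage n b ↔ a ≤ b := by
  refine ⟨?_, fun h => ⟨n, a, b, rfl, rfl, h⟩⟩
  rintro ⟨m, a', b', ha, hb, h⟩
  rw [← P.ofStage_trans n (max m n) (le_max_right m n),
    ← P.ofStage_trans m (max m n) (le_max_left m n)] at ha hb
  rw [← (P.trans_strictMono n (max m n) (le_max_right m n)).le_iff_le,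
    P.ofStage_injective _ ha, P.ofStage_injective _ hb]
  exact (P.trans_strictMono _ _ _).monotone h

noncomputable instance (P : PreLogField.{u}) : LinearOrder P.ΓEL where
  le_refl x := by
    obtain ⟨n, a, _, rfl, _⟩ := P.exists_ofStage₂ x x
    rw [ofStage_le]
  le_trans x y z := by
    obtain ⟨n, a, b, c, rfl, rfl, rfl⟩ := P.exists_ofStage₃ x y z
    simp only [ofStage_le]
    exact le_trans
  le_antisymm x y := by
    obtain ⟨n, a, b, rfl, rfl⟩ := P.exists_ofStage₂ x y
    simp only [ofStage_le]
    exact fun h h' => congrArg _ (le_antisymm h h')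
  le_total x y := by
    obtain ⟨n, a, b, rfl, rfl⟩ := P.exists_ofStage₂ x y
    simp only [ofStage_le]
    exact le_total a b
  toDecidableLE := Classical.decRel _

instance (P : PreLogField.{u}) : IsOrderedAddMonoid P.ΓEL where
  add_le_add_left x y h z := by
    obtain ⟨n, a, b, c, rfl, rfl, rfl⟩ := P.exists_ofStage₃ x y z
    rw [← map_add, ← map_add, ofStage_le]
    rw [ofStage_le] at h
    exact add_le_add_left h c

theorem ofStage_strictMono (P : PreLogField.{u}) (n : ℕ) : StrictMono (P.ofStage n) :=
  strictMono_of_le_iff_le fun a b => (P.ofStage_le n a b).symm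

theorem stage_l_trans (P : PreLogField.{u}) (m n : ℕ) (h : m ≤ n) (x : (P.stage m).Γ) :
    (P.stage n).l (P.trans m n h x) =
      mapInf (P.trans m n h) (P.trans_strictMono m n h) ((P.stage m).l x) := by
  induction n, h using Nat.le_induction with
  | base =>
    rw [trans_self]
    apply Subtype.ext
    exact (map_eq_self _ (P.trans_strictMono m m le_rfl) (P.trans_self m) _).symm
  | succ n h ih =>
    rw [trans_succ P m n h]
    change mapInf (P.step n) (P.step_strictMono n) ((P.stage n).l (P.trans m n h x)) = _
    rw [ih]
    apply Subtype.ext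
    exact map_map _ (P.trans_strictMono m n h) _ (P.step_strictMono n) _
      (P.trans_strictMono m (n + 1) (Nat.le_succ_of_le h)) (P.trans_succ m n h) _

/-- The section `Γ^EL → ℝ((Γ^EL))^{≻ 1}` that is the union of the sections `l^{♯n}`: it sends the
class of `α ∈ Γ^{♯n}` to `l^{♯n}(α)`, seen in `ℝ((Γ^EL))`. -/
noncomputable def lEL (P : PreLogField.{u}) : P.ΓEL →+ purelyInfinite P.ΓEL where
  toFun := DirectLimit.lift (F := fun n => (P.stage n).Γ) (fun m n h => P.trans m n h)
    (fun n x => mapInf (P.ofStage n) (P.ofStage_strictMono n) ((P.stage n).l x))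
    (by
      intro m n h x
      rw [stage_l_trans]
      apply Subtype.ext
      exact (map_map _ (P.trans_strictMono m n h) _ (P.ofStage_strictMono n) _
        (P.ofStage_strictMono m) (fun y => (P.ofStage_trans m n h y).symm) _).symm)
  map_zero' := by
    change mapInf (P.ofStage _) _ ((P.stage _).l 0) = 0
    rw [map_zero, map_zero]
  map_add' x y := by
    obtain ⟨n, a, b, rfl, rfl⟩ := P.exists_ofStage₂ x y
    rw [← map_add]
    change mapInf (P.ofStage n) _ ((P.stage n).l (a + b)) =
      mapInf (P.ofStage n) _ ((P.stage n).l a) + mapInf (P.ofStage n) _ ((P.stage n).l b)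
    rw [map_add, map_add]

/-- The pre-logarithmic series field `ℝ((Γ^EL))` with the union of the sections `l^{♯n}`. It
contains all the `K^{♯n}`, and the EL-series field is the union of the latter. -/
noncomputable def hull (P : PreLogField.{u}) : PreLogField.{u} where
  Γ := P.ΓEL
  l := P.lEL
  strictMono := by
    intro x y h
    obtain ⟨n, a, b, rfl, rfl⟩ := P.exists_ofStage₂ x y
    exact mapInf_strictMono _ _
      ((P.stage n).strictMono ((P.ofStage_strictMono n).lt_iff_lt.1 h))

/-- The embedding `Γ^{♯n} → Γ^EL`. -/
noncomputable def toHull (P : PreLogField.{u}) (n : ℕ) : (P.stage n).Γ →+ P.hull.Γ := P.ofStage n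

theorem toHull_strictMono (P : PreLogField.{u}) (n : ℕ) : StrictMono (P.toHull n) :=
  P.ofStage_strictMono n

/-- The embedding of fields `K^{♯n} → ℝ((Γ^EL))`. -/
noncomputable def embed (P : PreLogField.{u}) (n : ℕ) : (P.stage n).K →+* P.hull.K :=
  map (P.toHull n) (P.toHull_strictMono n)

/-- The embeddings `embed` are compatible with the inclusions `K^{♯m} → K^{♯n}`. -/
theorem embed_trans (P : PreLogField.{u}) (m n : ℕ) (h : m ≤ n) (a : (P.stage m).K) :
    P.embed n (map (P.trans m n h) (P.trans_strictMono m n h) a) = P.embed m a :=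
  map_map _ _ _ _ _ _ (fun y => (P.ofStage_trans m n h y).symm) _

theorem embed_log (P : PreLogField.{u}) (n : ℕ) (a : (P.stage n).K) :
    P.hull.log (P.embed n a) = P.embed n ((P.stage n).log a) :=
  map_log _ _ _ _ (fun _ => rfl) a

theorem exists_embed₂ (P : PreLogField.{u}) {x y : P.hull.K}
    (hx : ∃ n, x ∈ Set.range (P.embed n)) (hy : ∃ n, y ∈ Set.range (P.embed n)) :
    ∃ n a b, P.embed n a = x ∧ P.embed n b = y := by
  obtain ⟨m, a, rfl⟩ := hx
  obtain ⟨n, b, rfl⟩ := hy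
  exact ⟨max m n, _, _, P.embed_trans m _ (le_max_left m n) a,
    P.embed_trans n _ (le_max_right m n) b⟩

/-- The EL-series field `K^EL = ⋃ₙ K^{♯n}` over `(K, l)`, a subfield of `ℝ((Γ^EL))`. -/
def EL (P : PreLogField.{u}) : Subfield P.hull.K where
  carrier := {x | ∃ n, x ∈ Set.range (P.embed n)}
  mul_mem' hx hy := by
    obtain ⟨n, a, b, rfl, rfl⟩ := P.exists_embed₂ hx hy
    exact ⟨n, a * b, map_mul _ _ _⟩
  one_mem' := ⟨0, 1, map_one _⟩
  add_mem' hx hy := by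
    obtain ⟨n, a, b, rfl, rfl⟩ := P.exists_embed₂ hx hy
    exact ⟨n, a + b, map_add _ _ _⟩
  zero_mem' := ⟨0, 0, map_zero _⟩
  neg_mem' := by
    rintro _ ⟨n, a, rfl⟩
    exact ⟨n, -a, map_neg _ _⟩
  inv_mem' := by
    rintro _ ⟨n, a, rfl⟩
    exact ⟨n, a⁻¹, map_inv₀ _ _⟩

/-- The embedding `K → K^EL`. -/
noncomputable def toEL (P : PreLogField.{u}) : P.K →+* P.EL :=
  (P.embed 0).codRestrict P.EL fun a => ⟨0, a, rfl⟩

/-- The logarithm of `K^EL`, i.e. the union of the pre-logarithms `l^{♯n}`. -/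
noncomputable def logEL (P : PreLogField.{u}) (x : P.EL) : P.EL :=
  ⟨P.hull.log x, by
    obtain ⟨n, a, h⟩ := x.2
    exact ⟨n, (P.stage n).log a, by rw [← h, embed_log]⟩⟩

theorem logEL_embed (P : PreLogField.{u}) (n : ℕ) (a : (P.stage n).K) :
    P.logEL ⟨P.embed n a, n, a, rfl⟩ = ⟨P.embed n ((P.stage n).log a), n, _, rfl⟩ :=
  Subtype.ext (P.embed_log n a)

end PreLogField

section Derivations

/-- Derivations of a field `F`: additive maps with `(a b)' = a b' + b a'`. -/
abbrev Der (F : Type u) [Field F] : Type u := Derivation ℤ F F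

/-! Below, `F` is a field of series: a field together with an embedding `ι : F → ℝ((Γ))`. For
`ℝ((Γ))` itself `ι` is the identity, for `K^EL` it is the inclusion in `ℝ((Γ^EL))`. -/

variable {Γ : Type u} [AddCommGroup Γ] [LinearOrder Γ] [IsOrderedAddMonoid Γ]
variable {F : Type u} [Field F] (ι : F →+* Series Γ)

/-- Strong linearity of a derivation `d` on `F`: for all `a = ∑ a_α α` in `F`, the monomials `α` of
the support of `a` lie in `F`, the family `(a_α α')` is summable (the union of the supports is
anti-well-ordered and each monomial lies in finitely many of them), and `a' = ∑ a_α α'`. -/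
def StronglyLinear (d : Der F) : Prop :=
  ∀ a : F, ∃ m : (ι a).support → F, (∀ α, ι (m α) = mon (ofDual α.1)) ∧
    ∃ s : SummableFamily Γᵒᵈ ℝ (ι a).support,
      (∀ α, s α = (ι a).coeff α.1 • ι (d (m α))) ∧ s.hsum = ι (d a)

/-- Compatibility of a derivation `d` with a logarithm `log` on the positive elements of `F`:
`log(a)' = a' / a` for all `a > 0`. -/
def LogCompatible (log : F → F) (d : Der F) : Prop :=
  ∀ a : F, Pos (ι a) → d (log a) = d a / a

/-- Two nonzero series are comparable if they have the same leading fundamental monomial, i.e. if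
their leading monomials lie in the same archimedean class of `Γ`. -/
def Comparable (a b : Series Γ) : Prop :=
  ArchimedeanClass.mk (LM a) = ArchimedeanClass.mk (LM b)

/-- Hardy type derivations on `F`. Here `|LM a| = max (LM a) (LM a)⁻¹`, which reads
`max (LM a) (-LM a)` in additive notation, and the monomial `1` reads `0`. -/
structure IsHardyType (d : Der F) : Prop where
  /-- The field of constants is `ℝ`. -/
  constants : ι '' {a | d a = 0} = Set.range (C : ℝ → Series Γ)
  /-- l'Hospital's rule. -/
  lHospital : ∀ a b : F, a ≠ 0 → b ≠ 0 → ¬ Asymp (ι a) 1 → ¬ Asymp (ι b) 1 →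
    (Dom (ι a) (ι b) ↔ Dom (ι (d a)) (ι (d b)))
  /-- The logarithmic derivation is compatible with the dominance relation. -/
  logDeriv : ∀ a b : F, a ≠ 0 → b ≠ 0 → 0 < |LM (ι b)| → |LM (ι b)| < |LM (ι a)| →
    Dom (ι (d b / b)) (ι (d a / a)) ∧
      (Asymp (ι (d a / a)) (ι (d b / b)) ↔ Comparable (ι a) (ι b))

end Derivations

/-- The derivation `D` on `K^EL` is a strongly linear, log-compatible extension of the derivation
`d` on `K`. -/
structure IsELExtension (P : PreLogField.{u}) (d : Der P.K)
    (D : Der P.EL) : Prop where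
  extends_d : ∀ a : P.K, D (P.toEL a) = P.toEL (d a)
  stronglyLinear : StronglyLinear P.EL.subtype D
  logCompatible : LogCompatible P.EL.subtype P.logEL D

end ELSeries

/-! Log-compatibility forces `(e^a)' = a' e^a` for every monomial `e^a` of `K^♯`, and strong
linearity then fixes the derivation on all of `K^♯`. Induction along the `K^{♯n}` gives uniqueness.
For existence this formula is taken as the definition on monomials (`expDer`), extended by infinite
sums and glued along the union.

The crux of existence is the summability of the family `a' e^a` (`summing_expDer`). A failure
produces decreasing `a_n` and increasing monomials `γ_n` in the supports of `a_n'`, with `a_m - a_n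
≤ l(γ_n / γ_m)` for `m < n`. Each `γ_n` comes from the derivative of a monomial `α_n` of `a_n`.
After thinning, the `α_n` increase and `α_n` occurs in `a_m - a_n`, so (GA) gives `α_n² ≺ γ_n /
γ_m`. Then the monomials `γ_n / α_n²` increase, although they occur in the derivatives of the
decreasing monomials `1 / α_n`; this contradicts the strong linearity of `d` (`false_of_antitone`).
Since (GA) passes to `K^♯`, the construction iterates.

For the Hardy type property, the key fact is that `e^a ≺ e^b` implies `(e^a)' ≺ (e^b)'` for nonzero
`a`, `b` (`IsHardyType.l_LM_add_lt`). If `a' ≻ b'`, then l'Hospital's rule bounds `a' / b'` by the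
square of the leading monomial of `a`, and (GA) makes `e^{b-a}` larger than that square. Hence the
derivative of a series `x` with leading monomial `e^a ≠ 1` is led by the derivative of `e^a`, and
`x' / x ≍ a'`. So (HD1) and (HD2) pass to `K^♯`, while (HD3) for `K^♯` reduces to (HD2) for `K`. -/

namespace ELSeries

/-! ### Elementary rules for derivations of a field. -/

section DerBasic

variable {F : Type u} [Field F] (d : Der F)

/-- A derivation, from an additive map with the Leibniz rule. -/
def Der.ofLeibniz (D : F →+ F) (h : ∀ a b, D (a * b) = a * D b + b * D a) : Der F :=
  Derivation.mk' D.toIntLinearMap h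

theorem Der.map_zero : d 0 = 0 := Derivation.map_zero d

theorem Der.map_one : d 1 = 0 := Derivation.map_one_eq_zero d

theorem Der.map_add (a b : F) : d (a + b) = d a + d b := Derivation.map_add d a b

theorem Der.map_sub (a b : F) : d (a - b) = d a - d b := Derivation.map_sub d a b

theorem Der.map_mul (a b : F) : d (a * b) = a * d b + b * d a := Derivation.leibniz d a b

theorem Der.map_pow_succ (a : F) (n : ℕ) : d (a ^ (n + 1)) = (n + 1) * a ^ n * d a := by
  rw [Derivation.leibniz_pow]
  simp [mul_assoc]

theorem Der.map_inv (a : F) : d a⁻¹ = -(a⁻¹ ^ 2 * d a) := by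
  rw [Derivation.leibniz_inv]
  simp

end DerBasic

theorem exists_ne_zero_of_finsum_ne_zero {ι M : Type*} [AddCommMonoid M] {c : ι → M}
    (h : ∑ᶠ i, c i ≠ 0) : ∃ i, c i ≠ 0 := by
  contrapose! h
  exact finsum_eq_zero_of_forall_eq_zero h

/-! ### Strongly linear maps of series, determined by their values on monomials. -/

section StrongSum

variable {X Y : Type*} [LinearOrder X] [LinearOrder Y]

/-- A family of series `f g`, indexed by monomials, such that `∑ a_g f(g)` is summable for all
series `∑ a_g g`. -/
structure Summing (f : X → HahnSeries Y ℝ) : Prop where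
  isPWO : ∀ S : Set X, S.IsPWO → (⋃ g ∈ S, (f g).support).IsPWO
  finite : ∀ S : Set X, S.IsPWO → ∀ z, {g ∈ S | (f g).coeff z ≠ 0}.Finite

variable {f : X → HahnSeries Y ℝ}

theorem Summing.finite_support (hf : Summing f) (a : HahnSeries X ℝ) (z : Y) :
    (Function.support fun g => a.coeff g * (f g).coeff z).Finite :=
  (hf.finite a.support a.isPWO_support z).subset fun _ hg =>
    ⟨left_ne_zero_of_mul hg, right_ne_zero_of_mul hg⟩

/-- The strongly linear extension `∑ a_g g ↦ ∑ a_g f(g)` of `f`. -/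
noncomputable def strongSum (hf : Summing f) : HahnSeries X ℝ →+ HahnSeries Y ℝ where
  toFun a :=
    { coeff := fun z => ∑ᶠ g, a.coeff g * (f g).coeff z
      isPWO_support' := by
        refine (hf.isPWO a.support a.isPWO_support).mono fun z hz => ?_
        obtain ⟨g, hg⟩ := exists_ne_zero_of_finsum_ne_zero hz
        exact Set.mem_biUnion (x := g) (left_ne_zero_of_mul hg) (right_ne_zero_of_mul hg) }
  map_zero' := by ext z; simp
  map_add' a b := by
    ext z
    simp only [coeff_add, add_mul]
    exact finsum_add_distrib (hf.finite_support a z) (hf.finite_support b z)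

theorem strongSum_coeff (hf : Summing f) (a : HahnSeries X ℝ) (z : Y) :
    (strongSum hf a).coeff z = ∑ᶠ g, a.coeff g * (f g).coeff z := rfl

theorem support_strongSum_subset (hf : Summing f) (a : HahnSeries X ℝ) :
    (strongSum hf a).support ⊆ ⋃ g ∈ a.support, (f g).support := by
  intro z hz
  obtain ⟨g, hg⟩ := exists_ne_zero_of_finsum_ne_zero hz
  exact Set.mem_biUnion (x := g) (left_ne_zero_of_mul hg) (right_ne_zero_of_mul hg)

theorem strongSum_single (hf : Summing f) (g : X) (r : ℝ) :
    strongSum hf (single g r) = r • f g := by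
  ext z
  rw [strongSum_coeff, finsum_eq_single _ g fun x hx => by simp [coeff_single_of_ne hx]]
  simp

/-- The image of a summable family under a strongly linear extension. -/
noncomputable def Summing.family {ι : Type*} (hf : Summing f) (s : SummableFamily X ℝ ι) :
    SummableFamily Y ℝ ι where
  toFun i := strongSum hf (s i)
  isPWO_iUnion_support' := by
    refine (hf.isPWO _ s.isPWO_iUnion_support).mono (Set.iUnion_subset fun i z hz => ?_)
    obtain ⟨g, hg, hz⟩ := Set.mem_iUnion₂.1 (support_strongSum_subset hf _ hz)
    exact Set.mem_biUnion (Set.mem_iUnion.2 ⟨i, hg⟩) hz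
  finite_co_support' z := by
    refine ((hf.finite _ s.isPWO_iUnion_support z).biUnion
      fun g _ => s.finite_co_support g).subset fun i hi => ?_
    obtain ⟨g, hg, hz⟩ := Set.mem_iUnion₂.1 (support_strongSum_subset hf _ hi)
    exact Set.mem_biUnion (x := g) ⟨Set.mem_iUnion.2 ⟨i, hg⟩, hz⟩ hg

theorem Summing.family_apply {ι : Type*} (hf : Summing f) (s : SummableFamily X ℝ ι) (i : ι) :
    hf.family s i = strongSum hf (s i) := rfl

/-- At a fixed `z` only finitely many `g` in the union of the supports of `s` have `(f g).coeff z ≠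
0`, and each such `g` occurs in finitely many members of `s`. The interchange of the two sums is
therefore finite. -/
theorem Summing.hsum_family {ι : Type*} (hf : Summing f) (s : SummableFamily X ℝ ι) :
    (hf.family s).hsum = strongSum hf s.hsum := by
  ext z
  have hG := hf.finite _ s.isPWO_iUnion_support z
  have h1 (i : ι) : (hf.family s i).coeff z =
      ∑ g ∈ hG.toFinset, (s i).coeff g * (f g).coeff z := by
    refine finsum_eq_sum_of_support_subset _ fun g hg => ?_
    rw [Set.Finite.coe_toFinset]
    exact ⟨Set.mem_iUnion.2 ⟨i, left_ne_zero_of_mul hg⟩, right_ne_zero_of_mul hg⟩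
  have h2 : (strongSum hf s.hsum).coeff z =
      ∑ g ∈ hG.toFinset, (∑ᶠ i, (s i).coeff g) * (f g).coeff z := by
    refine finsum_eq_sum_of_support_subset _ fun g hg => ?_
    rw [Set.Finite.coe_toFinset]
    exact ⟨s.support_hsum_subset (left_ne_zero_of_mul hg), right_ne_zero_of_mul hg⟩
  rw [SummableFamily.coeff_hsum, h2, finsum_congr h1, finsum_sum_comm]
  · refine Finset.sum_congr rfl fun g _ => ?_
    rw [finsum_mul' _ _ (s.finite_co_support g)]
  · intro g _
    exact (s.finite_co_support g).subset fun i hi => left_ne_zero_of_mul hi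

/-- A series as the sum of its terms. -/
noncomputable def termFamily (a : HahnSeries X ℝ) : SummableFamily X ℝ X where
  toFun g := single g (a.coeff g)
  isPWO_iUnion_support' := by
    refine a.isPWO_support.mono (Set.iUnion_subset fun g z hz => ?_)
    rw [mem_support, coeff_single] at hz
    split_ifs at hz with h
    · subst h; exact hz
    · exact absurd rfl hz
  finite_co_support' z := by
    refine (Set.finite_singleton z).subset fun g hg => ?_
    by_contra h
    exact hg (coeff_single_of_ne (Ne.symm h))

theorem termFamily_apply (a : HahnSeries X ℝ) (g : X) :
    termFamily a g = single g (a.coeff g) := rfl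

theorem hsum_termFamily (a : HahnSeries X ℝ) : (termFamily a).hsum = a := by
  ext z
  rw [SummableFamily.coeff_hsum]
  simp only [termFamily_apply]
  rw [finsum_eq_single _ z fun g hg => coeff_single_of_ne hg.symm]
  exact coeff_single_same _ _

theorem finsum_support_mul (a : HahnSeries X ℝ) (c : X → ℝ) :
    ∑ᶠ α : a.support, a.coeff α.1 * c α.1 = ∑ᶠ g, a.coeff g * c g := by
  rw [finsum_set_coe_eq_finsum_mem (f := fun g => a.coeff g * c g)]
  refine finsum_congr fun g => ?_
  by_cases hg : a.coeff g = 0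
  · simp [hg]
  · have : g ∈ a.support := hg
    simp [this]

end StrongSum

/-! ### The Leibniz rule extends from monomials to series. -/

section StrongDer

variable {X : Type*} [AddCommGroup X] [LinearOrder X] [IsOrderedAddMonoid X]
  {f : X → HahnSeries X ℝ}

/-- Both factors are expanded into their terms: the Leibniz rule holds for each product of two
terms, and the resulting identity of summable families is summed. -/
theorem strongSum_mul (hf : Summing f)
    (hL : ∀ g h, f (g + h) = single g 1 * f h + single h 1 * f g) (a b : HahnSeries X ℝ) :
    strongSum hf (a * b) = a * strongSum hf b + b * strongSum hf a := by
  have key : hf.family ((termFamily a).mul (termFamily b)) =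
      (termFamily a).mul (hf.family (termFamily b)) +
        (hf.family (termFamily a)).mul (termFamily b) := by
    refine SummableFamily.ext fun i => ?_
    simp only [Summing.family_apply, SummableFamily.mul_toFun, SummableFamily.add_apply,
      termFamily_apply, single_mul_single, strongSum_single, hL]
    have h (g : X) (r : ℝ) : single g r = C r * single g (1 : ℝ) := by simp
    rw [h i.1 (a.coeff _), h i.2 (b.coeff _)]
    simp only [← C_mul_eq_smul, map_mul]
    ring
  have := congrArg SummableFamily.hsum key
  rwa [Summing.hsum_family, SummableFamily.hsum_add, SummableFamily.hsum_mul,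
    SummableFamily.hsum_mul, SummableFamily.hsum_mul, Summing.hsum_family, Summing.hsum_family,
    hsum_termFamily, hsum_termFamily, mul_comm (strongSum hf a)] at this

end StrongDer

/-! ### Strongly linear derivations of a full series field. -/

section Der

variable {Γ : Type u} [AddCommGroup Γ] [LinearOrder Γ] [IsOrderedAddMonoid Γ]

set_option synthInstance.maxHeartbeats 400000 in
noncomputable instance : Algebra ℝ (Series Γ) := inferInstance

set_option synthInstance.maxHeartbeats 400000 in
noncomputable instance : Module ℝ (Series Γ) := inferInstance

noncomputable instance : MulAction ℝ (Series Γ) := Module.toDistribMulAction.toMulAction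

/-- The derivation `∑ a_g g ↦ ∑ a_g f(g)`. -/
noncomputable def strongDer {f : Γᵒᵈ → Series Γ} (hf : Summing f)
    (hL : ∀ g h, f (g + h) = single g 1 * f h + single h 1 * f g) : Der (Series Γ) :=
  Der.ofLeibniz (strongSum hf) fun a b => strongSum_mul hf hL a b

variable {d : Der (Series Γ)}

theorem StronglyLinear.exists_family (hd : StronglyLinear (RingHom.id (Series Γ)) d)
    (a : Series Γ) : ∃ s : SummableFamily Γᵒᵈ ℝ a.support,
      (∀ α, s α = a.coeff α.1 • d (single α.1 1)) ∧ s.hsum = d a := by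
  obtain ⟨m, hm, s, hs, hsum⟩ := hd a
  refine ⟨s, fun α => ?_, hsum⟩
  have : m α = single α.1 1 := hm α
  rw [hs α, this]
  rfl

/-- Strong linearity speaks of one series at a time. Applied to the series with support `S` and all
coefficients `1`, it yields summability over an arbitrary anti-well-ordered set of monomials. -/
theorem StronglyLinear.summing (hd : StronglyLinear (RingHom.id (Series Γ)) d) :
    Summing fun g => d (single g 1) := by
  have key (S : Set Γᵒᵈ) (hS : S.IsPWO) : ∃ s : SummableFamily Γᵒᵈ ℝ S,
      ∀ α, s α = d (single α.1 1) := by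
    classical
    let a : Series Γ := ⟨S.indicator 1, hS.mono (by
      intro g hg
      by_contra h
      exact hg (Set.indicator_of_notMem h _))⟩
    have ha : a.support = S := by
      ext g
      change S.indicator 1 g ≠ (0 : ℝ) ↔ _
      simp
    obtain ⟨s, hs, -⟩ := hd.exists_family a
    refine ⟨SummableFamily.Equiv (Equiv.setCongr ha) s, fun α => ?_⟩
    rw [SummableFamily.Equiv_toFun, hs]
    have h1 : a.coeff α.1 = 1 := Set.indicator_of_mem α.2 1
    exact (congrArg (· • d (single α.1 1)) h1).trans (one_smul ℝ _)
  refine ⟨fun S hS => ?_, fun S hS z => ?_⟩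
  · obtain ⟨s, hs⟩ := key S hS
    have := s.isPWO_iUnion_support
    simp only [hs] at this
    rwa [Set.biUnion_eq_iUnion]
  · obtain ⟨s, hs⟩ := key S hS
    refine ((s.finite_co_support z).image Subtype.val).subset fun g hg => ⟨⟨g, hg.1⟩, ?_, rfl⟩
    rw [Function.mem_support, hs]
    exact hg.2

theorem StronglyLinear.eq_strongSum (hd : StronglyLinear (RingHom.id (Series Γ)) d)
    (a : Series Γ) : d a = strongSum hd.summing a := by
  obtain ⟨s, hs, h⟩ := hd.exists_family a
  ext z
  rw [← h, SummableFamily.coeff_hsum, strongSum_coeff, finsum_congr fun α => by rw [hs α]]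
  exact finsum_support_mul a fun g => (d (single g 1)).coeff z

theorem stronglyLinear_of_summing {f : Γᵒᵈ → Series Γ} (hf : Summing f)
    (h : ∀ a, d a = strongSum hf a) : StronglyLinear (RingHom.id (Series Γ)) d := by
  intro a
  refine ⟨fun α => single α.1 1, fun α => rfl, ⟨fun α => a.coeff α.1 • f α.1, ?_, ?_⟩, ?_, ?_⟩
  · refine (hf.isPWO a.support a.isPWO_support).mono (Set.iUnion_subset fun α z hz => ?_)
    exact Set.mem_biUnion α.2 (right_ne_zero_of_mul (a := a.coeff α.1) hz)
  · intro z
    refine Set.Finite.of_finite_image ((hf.finite a.support a.isPWO_support z).subset ?_)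
      Subtype.val_injective.injOn
    rintro _ ⟨α, hα, rfl⟩
    exact ⟨α.2, right_ne_zero_of_mul (a := a.coeff α.1) hα⟩
  · intro α
    change _ = a.coeff α.1 • d (single α.1 1)
    rw [h, strongSum_single, one_smul]
    rfl
  · change _ = d a
    rw [h]
    ext z
    exact finsum_support_mul a fun g => (f g).coeff z

theorem StronglyLinear.map_single (hd : StronglyLinear (RingHom.id (Series Γ)) d)
    (g : Γᵒᵈ) (r : ℝ) : d (single g r) = r • d (single g 1) := by
  rw [hd.eq_strongSum, strongSum_single]

theorem StronglyLinear.map_C (hd : StronglyLinear (RingHom.id (Series Γ)) d) (r : ℝ) :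
    d (C r) = 0 := by
  have h : d (single (0 : Γᵒᵈ) (1 : ℝ)) = 0 := d.map_one
  rw [C_apply, hd.map_single, h, smul_zero]

theorem StronglyLinear.map_smul (hd : StronglyLinear (RingHom.id (Series Γ)) d) (r : ℝ)
    (a : Series Γ) : d (r • a) = r • d a := by
  rw [← C_mul_eq_smul, Der.map_mul, hd.map_C, mul_zero, add_zero,
    C_mul_eq_smul]

theorem StronglyLinear.map_log1p (hd : StronglyLinear (RingHom.id (Series Γ)) d)
    {ε : Series Γ} (hε : 0 < ε.orderTop) : (1 + ε) * d (log1p ε) = d ε := by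
  rcases eq_or_ne ε 0 with rfl | h0
  · have : log1p (0 : Series Γ) = 0 := by
      unfold log1p
      rw [PowerSeries.heval_apply, SummableFamily.powerSeriesFamily_hsum_zero,
        PowerSeries.constantCoeff_log, zero_smul]
    rw [this, Der.map_zero, mul_zero]
  -- The factor `ε` keeps the exponents aligned: `ε (c ε^n)' = n c ε^n ε'` matches the `n`-th
  -- coefficient of `X` times the derivative of the logarithm series, with no shift of index. It is
  -- cancelled at the end, which is why `ε = 0` is treated separately.
  have h1 : ε * d (log1p ε) =
      PowerSeries.heval ε (PowerSeries.X * PowerSeries.derivative ℝ (PowerSeries.log ℝ)) * d ε := by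
    have key : ε • hd.summing.family (SummableFamily.powerSeriesFamily ε (PowerSeries.log ℝ)) =
        d ε • SummableFamily.powerSeriesFamily ε
          (PowerSeries.X * PowerSeries.derivative ℝ (PowerSeries.log ℝ)) := by
      refine SummableFamily.ext fun n => ?_
      rw [SummableFamily.smul_apply, SummableFamily.smul_apply, Summing.family_apply,
        ← hd.eq_strongSum, SummableFamily.powerSeriesFamily_of_orderTop_pos hε,
        SummableFamily.powerSeriesFamily_of_orderTop_pos hε, hd.map_smul]
      cases n with
      | zero => simp
      | succ n =>
        rw [PowerSeries.coeff_succ_X_mul, PowerSeries.coeff_derivative, Der.map_pow_succ,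
          ← C_mul_eq_smul, ← C_mul_eq_smul, RingHom.map_mul, RingHom.map_add, RingHom.map_one,
          map_natCast C, of_symm_smul_of_eq_mul, of_symm_smul_of_eq_mul]
        ring
    have := congrArg SummableFamily.hsum key
    rw [SummableFamily.hsum_smul, SummableFamily.hsum_smul, Summing.hsum_family,
      ← hd.eq_strongSum] at this
    rw [mul_comm (PowerSeries.heval _ _)]
    exact this
  have h2 : (1 + PowerSeries.X) * PowerSeries.derivative ℝ (PowerSeries.log ℝ) = 1 := by
    rw [PowerSeries.deriv_log]
    ext n
    cases n with
    | zero => simp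
    | succ n => simp [add_mul, PowerSeries.coeff_succ_X_mul, pow_succ]
  apply mul_left_cancel₀ h0
  have h3 : (1 + ε) * PowerSeries.heval ε
      (PowerSeries.X * PowerSeries.derivative ℝ (PowerSeries.log ℝ)) = ε := by
    have := congrArg (PowerSeries.heval ε) (congrArg (PowerSeries.X * ·) h2)
    simp only [map_mul, map_add, map_one, PowerSeries.heval_X _ hε, mul_one] at this
    rw [map_mul, PowerSeries.heval_X _ hε, ← mul_assoc, mul_comm (1 + ε), mul_assoc, this]
  rw [mul_left_comm, h1, ← mul_assoc, h3]

end Der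


/-! ### Log-compatibility can be tested on monomials. -/

section Log

theorem log1p_zero {Γ : Type u} [AddCommGroup Γ] [LinearOrder Γ] [IsOrderedAddMonoid Γ] :
    log1p (0 : Series Γ) = 0 := by
  unfold log1p
  rw [PowerSeries.heval_apply, SummableFamily.powerSeriesFamily_hsum_zero,
    PowerSeries.constantCoeff_log, zero_smul]

theorem mon_ne_zero {Γ : Type u} [AddCommGroup Γ] [LinearOrder Γ] [IsOrderedAddMonoid Γ] (g : Γ) :
    mon g ≠ 0 := by simp [mon]

variable {P : PreLogField.{u}}

theorem PreLogField.log_mon (g : P.Γ) : P.log (mon g) = P.sec g := by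
  have h1 : (mon g).leadingCoeff = 1 := leadingCoeff_of_single
  have h2 : LM (mon g) = g := congrArg ofDual (order_single one_ne_zero)
  have h3 : mon g * (C 1 * mon g)⁻¹ - 1 = 0 := by
    rw [map_one, one_mul, mul_inv_cancel₀ (mon_ne_zero g), sub_self]
  rw [PreLogField.log, h1, h2, h3, log1p_zero, Real.log_one, map_zero, zero_add, add_zero]

variable {d : Der P.K}

/-- A strongly linear derivation is compatible with the logarithm as soon as it is on monomials. -/
theorem logCompatible_iff (hd : StronglyLinear (RingHom.id P.K) d) :
    LogCompatible (RingHom.id P.K) P.log d ↔ ∀ g, d (mon g) = d (P.sec g) * mon g := by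
  refine ⟨fun h g => ?_, fun h a ha => ?_⟩
  · have h1 : Pos (mon g) := by
      have : (mon g).leadingCoeff = 1 := leadingCoeff_of_single
      rw [Pos, this]
      exact one_pos
    have h2 : d (P.log (mon g)) = d (mon g) / mon g := h (mon g) h1
    rw [← PreLogField.log_mon, h2, div_mul_cancel₀ _ (mon_ne_zero g)]
  · replace ha : 0 < a.leadingCoeff := ha
    have ha0 : a ≠ 0 := leadingCoeff_ne_zero.1 ha.ne'
    -- With `b` the leading term, `a = b (1 + ε)` with `ε ≺ 1`. The derivative of `log1p ε` is `a'/a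
    -- - b'/b`, and the hypothesis on monomials identifies `b'/b` with the derivative of `l(LM a)`.
    set b : P.K := C a.leadingCoeff * mon (LM a) with hb
    have hbs : b = single a.order a.leadingCoeff := by
      rw [hb, mon, LM, toDual_ofDual, C_apply, single_mul_single, zero_add, mul_one]
    have hb0 : b ≠ 0 := mul_ne_zero (by simpa using ha0) (mon_ne_zero _)
    have hy0 : a * b⁻¹ ≠ 0 := mul_ne_zero ha0 (inv_ne_zero hb0)
    have hε : 0 < (a * b⁻¹ - 1).orderTop := by
      rw [orderTop_self_sub_one_pos_iff, hbs, HahnSeries.inv_single, orderTop_mul,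
        orderTop_single (inv_ne_zero ha.ne'), ← order_eq_orderTop_of_ne_zero ha0,
        leadingCoeff_mul, leadingCoeff_of_single, mul_inv_cancel₀ ha.ne', ← WithTop.coe_add,
        add_neg_cancel]
      exact ⟨rfl, rfl⟩
    have h1 := hd.map_log1p hε
    rw [add_sub_cancel, Der.map_sub, Der.map_one, sub_zero, Der.map_mul, Der.map_inv] at h1
    have h2 : d b = d (P.sec (LM a)) * b := by
      rw [hb, Der.map_mul, hd.map_C, mul_zero, add_zero, h]
      ring
    change d (P.log a) = d a / a
    rw [PreLogField.log, ← hb, Der.map_add, Der.map_add, hd.map_C, zero_add]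
    have h3 : d (log1p (a * b⁻¹ - 1)) = d a / a - d (P.sec (LM a)) := by
      apply mul_left_cancel₀ hy0
      rw [h1, h2]
      field_simp
      ring
    rw [h3]
    ring

end Log

/-! ### Summability of the family `a' e^a`. -/

section Summability

variable {P : PreLogField.{u}}

theorem orderTop_le_of_le_purelyInfinite {Γ : Type u} [AddCommGroup Γ] [LinearOrder Γ]
    [IsOrderedAddMonoid Γ] {a b : purelyInfinite Γ} (ha : 0 ≤ a) (h : a ≤ b) :
    (ofLex b.1).orderTop ≤ (ofLex a.1).orderTop := by
  by_contra hlt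
  have h1 := abs_lt_abs_of_orderTop_ofLex (not_le.1 hlt)
  have h2 : (0 : Lex (Series Γ)) ≤ a.1 := ha
  have h3 : a.1 ≤ b.1 := h
  rw [abs_of_nonneg h2, abs_of_nonneg (h2.trans h3)] at h1
  exact absurd h3 (not_le.2 h1)

/-- If `α ≻ 1` is dominated by `l(δ)`, `δ ≻ 1`, then `α² ≺ δ`. -/
theorem PreLogField.GrowthAxiom.two_nsmul_lt (hGA : P.GrowthAxiom) {α δ : P.Γ} (hα : 0 < α)
    (hδ : 0 < δ) (h : (P.sec δ).orderTop ≤ ((toDual α : P.Γᵒᵈ) : WithTop P.Γᵒᵈ)) :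
    α + α < δ := by
  -- Otherwise `l(δ) ≤ 2 l(α)`, hence `l(δ) ≼ l(α) ≺ α` by (GA), against `α ≼ l(δ)`.
  by_contra hlt
  have h1 : P.l δ ≤ P.l (α + α) := P.strictMono.monotone (not_lt.1 hlt)
  have h2 : (0 : purelyInfinite P.Γ) ≤ P.l δ := by
    rw [← map_zero P.l]
    exact P.strictMono.monotone hδ.le
  have h3 := orderTop_le_of_le_purelyInfinite h2 h1
  have h4 : ofLex (P.l (α + α)).1 = P.sec α + P.sec α := by rw [map_add]; rfl
  have h5 : (P.sec α).orderTop ≤ (P.sec α + P.sec α).orderTop := by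
    simpa using min_orderTop_le_orderTop_add (x := P.sec α) (y := P.sec α)
  have h6 : (mon α).orderTop < (P.sec α).orderTop := hGA α hα
  rw [mon, orderTop_single one_ne_zero] at h6
  rw [h4] at h3
  exact absurd (h5.trans (h3.trans h)) (not_le.2 h6)

/-- Seen in the dual order, `γ` is an infinite descending sequence in a well-ordered union of
supports. This is the form in which summability gets contradicted in `false_of_antitone`. -/
theorem Summing.false_of_strictMono {Γ Γ' : Type*} [LinearOrder Γ] [LinearOrder Γ']
    {f : Γᵒᵈ → HahnSeries Γ'ᵒᵈ ℝ} (hf : Summing f) {S : Set Γᵒᵈ} (hS : S.IsPWO) (α : ℕ → Γ)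
    (hα : ∀ n, toDual (α n) ∈ S) (γ : ℕ → Γ') (hγ : StrictMono γ)
    (h : ∀ n, (f (toDual (α n))).coeff (toDual (γ n)) ≠ 0) : False := by
  obtain ⟨m, n, hmn, hle⟩ := (hf.isPWO S hS).exists_lt (f := fun n => toDual (γ n))
    (fun n => Set.mem_biUnion (hα n) (h n))
  exact absurd (hγ hmn) (not_lt.2 hle)

theorem isPWO_range_of_antitone {Γ : Type*} [LinearOrder Γ] {α : ℕ → Γ} (h : Antitone α) :
    (Set.range fun n => toDual (α n)).IsPWO := by
  rw [← Set.image_univ]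
  exact (Set.isPWO_of_wellQuasiOrderedLE _).image_of_monotone h

/-- The combinatorial core of the summability of the family `(a' e^a)`. -/
theorem false_of_antitone (hGA : P.GrowthAxiom) {d : Der P.K}
    (hd : StronglyLinear (RingHom.id P.K) d) (a : ℕ → purelyInfinite P.Γ) (γ : ℕ → P.Γ)
    (ha : Antitone a) (hγ : StrictMono γ)
    (h : ∀ n, (d (ofLex (a n).1)).coeff (toDual (γ n)) ≠ 0)
    (hle : ∀ m n, m < n → a m - a n ≤ P.l (γ n - γ m)) : False := by
  have hf := hd.summing
  -- Each `γ n` already occurs in the derivative of a single monomial of `a n`.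
  have h1 (n : ℕ) : ∃ α : P.Γ, (ofLex (a n).1).coeff (toDual α) ≠ 0 ∧
      (d (single (toDual α) 1)).coeff (toDual (γ n)) ≠ 0 := by
    have := h n
    rw [hd.eq_strongSum] at this
    obtain ⟨g, hg, hg'⟩ := Set.mem_iUnion₂.1 (support_strongSum_subset hf _ this)
    exact ⟨ofDual g, hg, hg'⟩
  choose α hα hαγ using h1
  have hpos (n : ℕ) : 0 < α n := (a n).2 _ (hα n)
  -- A nonincreasing subsequence of `α` would have anti-well-ordered range, while the derivatives of
  -- its members contain increasing `γ`; so some subsequence increases strictly.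
  obtain ⟨φ, hφ⟩ := exists_increasing_or_nonincreasing_subseq (· < ·) α
  have hmono : StrictMono (α ∘ φ) := by
    rcases hφ with hφ | hφ
    · exact fun m n hmn => hφ m n hmn
    · refine (hf.false_of_strictMono (isPWO_range_of_antitone (α := α ∘ φ) ?_) (α ∘ φ)
        (fun n => ⟨n, rfl⟩) (γ ∘ φ) (hγ.comp φ.strictMono) fun n => hαγ _).elim
      intro m n hmn
      rcases hmn.eq_or_lt with rfl | hmn
      · exact le_rfl
      · exact not_lt.1 (hφ m n hmn)
  -- For the same reason, the anti-well-ordered support of one `a m` contains `α n` for only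
  -- finitely many `n`.
  have hfin (m : ℕ) : {n | (ofLex (a m).1).coeff (toDual (α n)) ≠ 0}.Finite := by
    by_contra hinf
    obtain ⟨ψ, hψ, hψm⟩ : ∃ ψ : ℕ → ℕ, StrictMono ψ ∧
        ∀ n, (ofLex (a m).1).coeff (toDual (α (ψ n))) ≠ 0 :=
      ⟨_, Nat.nth_strictMono hinf, fun n => Nat.nth_mem_of_infinite hinf n⟩
    exact hf.false_of_strictMono (ofLex (a m).1).isPWO_support (α ∘ ψ) hψm (γ ∘ ψ) (hγ.comp hψ)
      fun n => hαγ _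
  -- A further thinning puts each chosen `α` outside the supports of all earlier chosen `a`, so that
  -- it cannot cancel in the differences `a m - a n`.
  obtain ⟨ψ, -, hψ⟩ := exists_seq_of_forall_finset_exists (fun _ : ℕ => True)
    (fun m n => m < n ∧ (ofLex (a (φ m)).1).coeff (toDual (α (φ n))) = 0) (by
      intro s _
      have hbad : (⋃ m ∈ s, {n | (ofLex (a (φ m)).1).coeff (toDual (α (φ n))) ≠ 0}).Finite :=
        s.finite_toSet.biUnion fun m _ => (hfin (φ m)).preimage φ.injective.injOn
      obtain ⟨n, hn⟩ := (hbad.union (s.finite_toSet.biUnion fun m _ =>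
        Set.finite_Iic m)).infinite_compl.nonempty
      simp only [Set.mem_compl_iff, Set.mem_union, Set.mem_iUnion, not_or, not_exists] at hn
      refine ⟨n, trivial, fun m hm => ⟨?_, ?_⟩⟩
      · exact not_le.1 (hn.2 m hm)
      · exact not_not.1 (hn.1 m hm))
  have hψmono : StrictMono ψ := fun m n hmn => (hψ m n hmn).1
  set θ : ℕ → ℕ := φ ∘ ψ with hθ
  have hθmono : StrictMono θ := φ.strictMono.comp hψmono
  have hαθ : StrictMono (α ∘ θ) := hmono.comp hψmono
  -- Here `α_n ≼ a_m - a_n ≼ l(γ_n / γ_m)`, and (GA) turns this into `α_n² ≺ γ_n / γ_m`.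
  have key (m n : ℕ) (hmn : m < n) : α (θ n) + α (θ n) < γ (θ n) - γ (θ m) := by
    refine hGA.two_nsmul_lt (hpos _) (sub_pos.2 (hγ (hθmono hmn))) ?_
    refine (orderTop_le_of_le_purelyInfinite (sub_nonneg.2 (ha (hθmono hmn).le))
      (hle _ _ (hθmono hmn))).trans ?_
    refine orderTop_le_of_coeff_ne_zero ?_
    change (ofLex (a (θ m)).1 - ofLex (a (θ n)).1).coeff (toDual (α (θ n))) ≠ 0
    have h0 : (ofLex (a (θ m)).1).coeff (toDual (α (θ n))) = 0 := (hψ m n hmn).2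
    rw [coeff_sub, h0, zero_sub, neg_ne_zero]
    exact hα _
  -- The inverses `1 / α_n` decrease, and `(1 / α_n)' = -α_n' / α_n²` contains `γ_n / α_n²`. By
  -- `key`, `γ_m / α_m² ≺ γ_m ≺ γ_n / α_n²` for `m < n`.
  refine hf.false_of_strictMono (isPWO_range_of_antitone (α := fun n => -α (θ n)) ?_)
    (fun n => -α (θ n)) (fun n => ⟨n, rfl⟩) (fun n => γ (θ n) - (α (θ n) + α (θ n))) ?_ ?_
  · exact fun m n hmn => neg_le_neg (hαθ.monotone hmn)
  · intro m n hmn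
    have h1 := key m n hmn
    have h2 := hpos (θ m)
    rw [lt_sub_iff_add_lt]
    rw [lt_sub_iff_add_lt] at h1
    calc γ (θ m) - (α (θ m) + α (θ m)) + (α (θ n) + α (θ n))
        ≤ γ (θ m) + (α (θ n) + α (θ n)) := by
          gcongr
          exact sub_le_self _ (add_pos h2 h2).le
      _ < _ := by rwa [add_comm]
  · intro n
    have h1 : single (toDual (-α (θ n))) (1 : ℝ) = (single (toDual (α (θ n))) 1)⁻¹ := by
      rw [HahnSeries.inv_single, inv_one]
      rfl
    rw [h1, Der.map_inv, coeff_neg, neg_ne_zero, ← h1, pow_two, single_mul_single, one_mul]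
    have h2 : toDual (γ (θ n) - (α (θ n) + α (θ n))) =
        toDual (-α (θ n)) + toDual (-α (θ n)) + toDual (γ (θ n)) := by
      apply ofDual.injective
      change γ (θ n) - (α (θ n) + α (θ n)) = -α (θ n) + -α (θ n) + γ (θ n)
      abel
    rw [h2, add_comm _ (toDual (γ (θ n))), coeff_single_mul_add, one_mul]
    exact hαγ _

/-- The derivative `(e^a)' = a' e^a` of the monomial `e^a` of `K^♯`. -/
noncomputable def expDer (P : PreLogField.{u}) (d : Der P.K) (x : (purelyInfinite P.Γ)ᵒᵈ) :
    Series (purelyInfinite P.Γ) :=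
  map P.l P.strictMono (d (ofLex (ofDual x).1)) * single x 1

theorem expDer_coeff (d : Der P.K) (x z : (purelyInfinite P.Γ)ᵒᵈ) :
    (expDer P d x).coeff z = (map P.l P.strictMono (d (ofLex (ofDual x).1))).coeff (z - x) := by
  rw [expDer, coeff_mul_single, mul_one]

theorem exists_of_expDer_coeff_ne_zero {d : Der P.K} {x z : (purelyInfinite P.Γ)ᵒᵈ}
    (h : (expDer P d x).coeff z ≠ 0) :
    ∃ γ, (d (ofLex (ofDual x).1)).coeff (toDual γ) ≠ 0 ∧ ofDual z = P.l γ + ofDual x := by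
  rw [expDer_coeff] at h
  by_cases hz : ofDual (z - x) ∈ Set.range P.l
  · obtain ⟨γ, hγ⟩ := hz
    refine ⟨γ, ?_, ?_⟩
    · rwa [← map_coeff P.l P.strictMono, hγ]
    · rw [hγ]
      exact (sub_add_cancel (ofDual z) (ofDual x)).symm
  · exact absurd (map_coeff_of_notMem P.l P.strictMono _ _ hz) h

/-- A monomial of `a' e^a` is `e^{l(γ) + a}` with `γ` in the support of `a'`. Failure of
well-ordering gives nonincreasing `a_n` with strictly increasing monomials `z_n`; failure of
finiteness gives strictly decreasing `a_n` with `z_n` constant. In both cases `l(γ_n) - l(γ_m) =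
(z_n - z_m) + (a_m - a_n)` is positive for `m < n` and at least `a_m - a_n`, as `false_of_antitone`
requires. -/
theorem summing_expDer (hGA : P.GrowthAxiom) {d : Der P.K}
    (hd : StronglyLinear (RingHom.id P.K) d) : Summing (expDer P d) := by
  have core (x z : ℕ → (purelyInfinite P.Γ)ᵒᵈ) (hx : Monotone x)
      (hz : ∀ n, (expDer P d (x n)).coeff (z n) ≠ 0) (hz' : Antitone z)
      (hlt : ∀ m n, m < n → x m < x n ∨ z n < z m) : False := by
    choose γ hγ hzγ using fun n => exists_of_expDer_coeff_ne_zero (hz n)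
    have h1 (m n : ℕ) (hmn : m < n) :
        P.l (γ n) - P.l (γ m) = (ofDual (z n) - ofDual (z m)) + (ofDual (x m) - ofDual (x n)) := by
      rw [hzγ, hzγ]
      abel
    refine false_of_antitone hGA hd (fun n => ofDual (x n)) γ (fun m n h => hx h) ?_ hγ ?_
    · intro m n hmn
      rw [← P.strictMono.lt_iff_lt, ← sub_pos, h1 m n hmn]
      rcases hlt m n hmn with h | h
      · exact add_pos_of_nonneg_of_pos (sub_nonneg.2 (hz' hmn.le)) (sub_pos.2 h)
      · exact add_pos_of_pos_of_nonneg (sub_pos.2 h) (sub_nonneg.2 (hx hmn.le))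
    · intro m n hmn
      rw [map_sub, h1 m n hmn]
      exact le_add_of_nonneg_left (sub_nonneg.2 (hz' hmn.le))
  refine ⟨fun S hS => ?_, fun S hS z => ?_⟩
  · rw [Set.IsPWO, Set.partiallyWellOrderedOn_iff_exists_lt]
    intro z hz
    by_contra! hbad
    choose x hxS hx using fun n => Set.mem_iUnion₂.1 (hz n)
    obtain ⟨φ, hφ⟩ := hS.exists_monotone_subseq hxS
    have hanti : StrictAnti (z ∘ φ) := fun m n hmn => hbad _ _ (φ.strictMono hmn)
    exact core (x ∘ φ) (z ∘ φ) hφ (fun n => hx _) hanti.antitone fun m n hmn => Or.inr (hanti hmn)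
  · by_contra hinf
    let x := Set.Infinite.natEmbedding _ hinf
    obtain ⟨φ, hφ⟩ := hS.exists_monotone_subseq (f := fun n => (x n).1) fun n => (x n).2.1
    refine core _ (fun _ => z) hφ (fun n => (x _).2.2) antitone_const fun m n hmn => Or.inl ?_
    refine lt_of_le_of_ne (hφ hmn.le) fun h => ?_
    exact hmn.ne (φ.injective (x.injective (Subtype.ext h)))

theorem expDer_add (d : Der P.K) (x y : (purelyInfinite P.Γ)ᵒᵈ) :
    expDer P d (x + y) = single x 1 * expDer P d y + single y 1 * expDer P d x := by
  have h1 : ofLex (ofDual (x + y)).1 = ofLex (ofDual x).1 + ofLex (ofDual y).1 := rfl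
  have h2 : single (x + y) (1 : ℝ) = single x 1 * single y 1 := by
    rw [single_mul_single, one_mul]
  rw [expDer, expDer, expDer, h1, h2, Der.map_add, RingHom.map_add]
  ring

end Summability

/-! ### Extension of the derivation from `K` to `K^♯`. -/

section Sharp

theorem finsum_map_coeff_mul {Γ : Type u} [AddCommGroup Γ] [LinearOrder Γ] [IsOrderedAddMonoid Γ]
    {Γ' : Type v} [AddCommGroup Γ'] [LinearOrder Γ'] [IsOrderedAddMonoid Γ']
    (f : Γ →+ Γ') (hf : StrictMono f) (a : Series Γ) (c : Γ'ᵒᵈ → ℝ) :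
    ∑ᶠ x, (map f hf a).coeff x * c x = ∑ᶠ g, a.coeff g * c (dualHom f g) := by
  have h1 (g : Γᵒᵈ) : a.coeff g * c (dualHom f g) =
      (map f hf a).coeff (dualHom f g) * c (dualHom f g) :=
    congrArg (· * _) (map_coeff f hf a (ofDual g)).symm
  rw [finsum_congr h1, ← finsum_mem_range (f := fun x => (map f hf a).coeff x * c x)
    (dualHom_injective f hf)]
  refine finsum_congr fun x => ?_
  by_cases hx : x ∈ Set.range (dualHom f)
  · simp [hx]
  · have : (map f hf a).coeff x = 0 := embDomain_of_notMem_range hx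
    simp [this]

theorem coeff_map_strongSum {Γ : Type u} [AddCommGroup Γ] [LinearOrder Γ] [IsOrderedAddMonoid Γ]
    {Γ' : Type v} [AddCommGroup Γ'] [LinearOrder Γ'] [IsOrderedAddMonoid Γ']
    (f : Γ →+ Γ') (hf : StrictMono f) {c : Γᵒᵈ → Series Γ} (hc : Summing c) (a : Series Γ)
    (z : Γ'ᵒᵈ) :
    (map f hf (strongSum hc a)).coeff z = ∑ᶠ g, a.coeff g * (map f hf (c g)).coeff z := by
  by_cases hz : ofDual z ∈ Set.range f
  · obtain ⟨w, hw⟩ := hz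
    obtain rfl : z = toDual (f w) := hw.symm
    simp only [map_coeff]
    rfl
  · have h0 (b : Series Γ) : (map f hf b).coeff z = 0 := map_coeff_of_notMem f hf b (ofDual z) hz
    simp [h0]

variable {P : PreLogField.{u}}

/-- (GA) passes from `K` to `K^♯`. -/
theorem PreLogField.GrowthAxiom.sharp (hGA : P.GrowthAxiom) : P.sharp.GrowthAxiom := by
  intro a ha
  change purelyInfinite P.Γ at a
  replace ha : 0 < a := ha
  have ha0 : ofLex a.1 ≠ 0 := fun h => ha.ne' (Subtype.ext h)
  have ho := order_eq_orderTop_of_ne_zero ha0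
  set α : P.Γ := ofDual (ofLex a.1).order with hα
  have hαpos : 0 < α := a.2 _ (coeff_orderTop_ne ho.symm)
  change (mon a).orderTop < (map P.l P.strictMono (ofLex a.1)).orderTop
  rw [map_orderTop, ← ho, mon, orderTop_single one_ne_zero, WithTop.map_coe, WithTop.coe_lt_coe]
  -- The leading monomial of `l^♯(e^a) = a` in `K^♯` is `α = e^{l(α)}`, to be compared with `e^a`.
  -- The inequality holds because `l(α) ≺ α ≍ a` and `a > 0`.
  change P.l α < a
  by_contra hle
  have h1 := orderTop_le_of_le_purelyInfinite ha.le (not_lt.1 hle)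
  have h2 : (mon α).orderTop < (P.sec α).orderTop := hGA α hαpos
  rw [mon, orderTop_single one_ne_zero] at h2
  refine absurd h2 (not_lt.2 (h1.trans ?_))
  rw [← ho]
  exact le_rfl

variable (hGA : P.GrowthAxiom) {d : Der P.K} (hd : StronglyLinear (RingHom.id P.K) d)

/-- The extension of a derivation from `K` to `K^♯`. -/
noncomputable def sharpDer : Der P.sharp.K :=
  strongDer (summing_expDer hGA hd) (expDer_add d)

theorem stronglyLinear_sharpDer : StronglyLinear (RingHom.id P.sharp.K) (sharpDer hGA hd) :=
  stronglyLinear_of_summing (summing_expDer hGA hd) fun _ => rfl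

/-- The embedding of fields `K → K^♯`. -/
noncomputable def PreLogField.toSharp (P : PreLogField.{u}) : P.K →+* P.sharp.K :=
  map (Γ' := P.sharp.Γ) P.l P.strictMono

theorem sharpDer_mon (a : P.sharp.Γ) :
    sharpDer hGA hd (mon a) = P.toSharp (d (ofLex a.1)) * mon a := by
  have := strongSum_single (summing_expDer hGA hd) (toDual a) 1
  rw [one_smul] at this
  exact this

/-- A monomial `α` of `K` is `e^{l(α)}` in `K^♯`, and log-compatibility of `d` says exactly that `α'
= l(α)' α`. The two derivations thus agree on monomials, hence on all series by strong linearity. -/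
theorem strongSum_expDer_map (hlc : LogCompatible (RingHom.id P.K) P.log d) (a : P.K) :
    strongSum (summing_expDer hGA hd) (map P.l P.strictMono a) = map P.l P.strictMono (d a) := by
  have h1 (g : P.Γᵒᵈ) : expDer P d (dualHom P.l g) =
      map P.l P.strictMono (d (single g 1)) := by
    have := (logCompatible_iff hd).1 hlc (ofDual g)
    change d (single g 1) = d (P.sec (ofDual g)) * single g 1 at this
    rw [this, RingHom.map_mul, map_single]
    rfl
  ext z
  rw [hd.eq_strongSum a, strongSum_coeff, finsum_map_coeff_mul, coeff_map_strongSum]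
  simp only [h1]

theorem sharpDer_toSharp (hlc : LogCompatible (RingHom.id P.K) P.log d) (a : P.K) :
    sharpDer hGA hd (P.toSharp a) = P.toSharp (d a) :=
  strongSum_expDer_map hGA hd hlc a

theorem logCompatible_sharpDer (hlc : LogCompatible (RingHom.id P.K) P.log d) :
    LogCompatible (RingHom.id P.sharp.K) P.sharp.log (sharpDer hGA hd) := by
  rw [logCompatible_iff (stronglyLinear_sharpDer hGA hd)]
  intro g
  rw [sharpDer_mon hGA hd g, ← sharpDer_toSharp hGA hd hlc]
  rfl

end Sharp


/-! ### `K^EL` as the union of the `K^{♯n}`. -/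

namespace PreLogField

variable (P : PreLogField.{u})

/-- The embedding `K^{♯n} → K^EL`. -/
noncomputable def embedEL (n : ℕ) : (P.stage n).K →+* P.EL :=
  (P.embed n).codRestrict P.EL fun a => ⟨n, a, rfl⟩

theorem exists_embedEL₂ (x y : P.EL) : ∃ n a b, P.embedEL n a = x ∧ P.embedEL n b = y := by
  obtain ⟨n, a, b, ha, hb⟩ := P.exists_embed₂ x.2 y.2
  exact ⟨n, a, b, Subtype.ext ha, Subtype.ext hb⟩

theorem exists_embedEL (x : P.EL) : ∃ n a, P.embedEL n a = x := by
  obtain ⟨n, a, _, h, _⟩ := P.exists_embedEL₂ x x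
  exact ⟨n, a, h⟩

theorem ofStage_step (n : ℕ) (x : (P.stage n).Γ) :
    P.ofStage (n + 1) (P.step n x) = P.ofStage n x := by
  rw [← P.ofStage_trans n (n + 1) n.le_succ x, P.trans_succ n n le_rfl, P.trans_self]

theorem embedEL_toSharp (n : ℕ) (a : (P.stage n).K) :
    P.embedEL (n + 1) ((P.stage n).toSharp a) = P.embedEL n a :=
  Subtype.ext (map_map (P.step n) (P.step_strictMono n) (P.toHull (n + 1))
    (P.toHull_strictMono (n + 1)) (P.toHull n) (P.toHull_strictMono n)
    (fun x => (P.ofStage_step n x).symm) a)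

theorem logEL_embedEL (n : ℕ) (a : (P.stage n).K) :
    P.logEL (P.embedEL n a) = P.embedEL n ((P.stage n).log a) :=
  P.logEL_embed n a

theorem embed_mon (n : ℕ) (g : (P.stage n).Γ) : P.embed n (mon g) = mon (P.toHull n g) :=
  map_single _ _ _ _

theorem pos_embed (n : ℕ) (a : (P.stage n).K) : Pos (P.embed n a) ↔ Pos a := by
  unfold Pos embed
  rw [map_leadingCoeff]

theorem exists_of_mem_support_embed {n : ℕ} {a : (P.stage n).K} {x : P.hull.Γᵒᵈ}
    (hx : x ∈ (P.embed n a).support) : ∃ g, g ∈ a.support ∧ x = dualHom (P.toHull n) g := by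
  by_cases h : ofDual x ∈ Set.range (P.toHull n)
  · obtain ⟨g, hg⟩ := h
    obtain rfl : x = toDual (P.toHull n g) := hg.symm
    refine ⟨toDual g, ?_, rfl⟩
    rw [mem_support] at hx ⊢
    rwa [← map_coeff (P.toHull n) (P.toHull_strictMono n)]
  · exact absurd (map_coeff_of_notMem _ (P.toHull_strictMono n) a _ h) hx

end PreLogField

/-! ### Gluing compatible derivations along the union. -/

section Glue

variable {P : PreLogField.{u}}

/-- A compatible sequence of strongly linear and log-compatible derivations of the `K^{♯n}`. -/
structure DerTower (P : PreLogField.{u}) where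
  D : ∀ n, Der (P.stage n).K
  stronglyLinear : ∀ n, StronglyLinear (RingHom.id _) (D n)
  logCompatible : ∀ n, LogCompatible (RingHom.id _) (P.stage n).log (D n)
  D_toSharp : ∀ n a, D (n + 1) ((P.stage n).toSharp a) = (P.stage n).toSharp (D n a)

namespace DerTower

variable (T : DerTower P)

theorem exists_lift {m n : ℕ} (h : m ≤ n) (a : (P.stage m).K) :
    ∃ b, P.embedEL n b = P.embedEL m a ∧ P.embedEL n (T.D n b) = P.embedEL m (T.D m a) := by
  induction n, h using Nat.le_induction with
  | base => exact ⟨a, rfl, rfl⟩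
  | succ n h ih =>
    obtain ⟨b, hb, hb'⟩ := ih
    exact ⟨(P.stage n).toSharp b, by rw [P.embedEL_toSharp, hb],
      by rw [T.D_toSharp, P.embedEL_toSharp, hb']⟩

/-- The derivative does not depend on the stage representing an element: both representatives lift
to a common stage, whose embedding is injective. -/
theorem embedEL_D_congr {m n : ℕ} {a : (P.stage m).K} {b : (P.stage n).K}
    (h : P.embedEL m a = P.embedEL n b) :
    P.embedEL m (T.D m a) = P.embedEL n (T.D n b) := by
  obtain ⟨a', ha, ha'⟩ := T.exists_lift (le_max_left m n) a
  obtain ⟨b', hb, hb'⟩ := T.exists_lift (le_max_right m n) b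
  rw [← ha', ← hb', (P.embedEL (max m n)).injective (ha.trans (h.trans hb.symm))]

/-- The union of the derivations, as a function. -/
noncomputable def glueFun (x : P.EL) : P.EL :=
  P.embedEL _ (T.D _ (P.exists_embedEL x).choose_spec.choose)

theorem glueFun_embedEL (n : ℕ) (a : (P.stage n).K) :
    T.glueFun (P.embedEL n a) = P.embedEL n (T.D n a) :=
  T.embedEL_D_congr (P.exists_embedEL (P.embedEL n a)).choose_spec.choose_spec

/-- The union of the derivations of a tower. -/
noncomputable def glue : Der P.EL :=
  Der.ofLeibniz
    { toFun := T.glueFun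
      map_zero' := by
        rw [← map_zero (P.embedEL 0), T.glueFun_embedEL, Der.map_zero]
      map_add' := fun x y => by
        obtain ⟨n, a, b, rfl, rfl⟩ := P.exists_embedEL₂ x y
        rw [← RingHom.map_add, T.glueFun_embedEL, T.glueFun_embedEL, T.glueFun_embedEL,
          Der.map_add, RingHom.map_add] }
    fun x y => by
      obtain ⟨n, a, b, rfl, rfl⟩ := P.exists_embedEL₂ x y
      change T.glueFun _ = _ * T.glueFun _ + _ * T.glueFun _
      rw [← RingHom.map_mul, T.glueFun_embedEL, T.glueFun_embedEL, T.glueFun_embedEL,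
        Der.map_mul, RingHom.map_add, RingHom.map_mul, RingHom.map_mul]

theorem glue_embedEL (n : ℕ) (a : (P.stage n).K) :
    T.glue (P.embedEL n a) = P.embedEL n (T.D n a) :=
  T.glueFun_embedEL n a

theorem logCompatible_glue : LogCompatible P.EL.subtype P.logEL T.glue := by
  intro x hx
  obtain ⟨n, a, rfl⟩ := P.exists_embedEL x
  have ha : Pos a := (P.pos_embed n a).1 hx
  have h : T.D n ((P.stage n).log a) = T.D n a / a := T.logCompatible n a ha
  rw [P.logEL_embedEL, T.glue_embedEL, T.glue_embedEL, h, map_div₀]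

theorem stronglyLinear_glue : StronglyLinear P.EL.subtype T.glue := by
  intro x
  obtain ⟨n, a, rfl⟩ := P.exists_embedEL x
  have hT := (T.stronglyLinear n).summing
  have hmono := P.toHull_strictMono n
  let e : (P.stage n).Γᵒᵈ → P.hull.Γᵒᵈ := dualHom (P.toHull n)
  have he : Function.Injective e := dualHom_injective _ hmono
  -- The values of `r` off the range of `e` are arbitrary but harmless, since the support of
  -- `P.embed n a` lies in that range.
  let r : P.hull.Γᵒᵈ → (P.stage n).Γᵒᵈ := Function.invFun e
  have hr (g) : r (e g) = g := Function.leftInverse_invFun he g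
  let c (y : P.hull.Γᵒᵈ) : P.hull.K := P.embed n (T.D n (single (r y) 1))
  refine ⟨fun α => P.embedEL n (single (r α.1) 1), fun α => ?_,
    ⟨fun α => (P.embed n a).coeff α.1 • c α.1, ?_, ?_⟩, fun α => ?_, ?_⟩
  · obtain ⟨g, -, hg⟩ := P.exists_of_mem_support_embed α.2
    have h1 : r α.1 = g := by rw [hg]; exact hr g
    change P.EL.subtype (P.embedEL n (single (r α.1) 1)) = _
    rw [h1, hg]
    exact P.embed_mon n (ofDual g)
  · refine ((hT.isPWO a.support a.isPWO_support).image_of_monotone (f := e) ?_).mono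
      (Set.iUnion_subset fun α z hz => ?_)
    · exact fun x y h => (dualHom_le_iff _ hmono x y).2 h
    · obtain ⟨g, hga, hg⟩ := P.exists_of_mem_support_embed α.2
      have h1 : r α.1 = g := by rw [hg]; exact hr g
      have h2 : z ∈ (c α.1).support := right_ne_zero_of_mul (a := (P.embed n a).coeff α.1) hz
      obtain ⟨w, hw, rfl⟩ := P.exists_of_mem_support_embed h2
      refine ⟨w, Set.mem_biUnion hga ?_, rfl⟩
      rwa [h1] at hw
  · intro z
    refine Set.Finite.of_finite_image (f := fun α => r α.1) ?_ ?_
    · by_cases hz : ∃ w, z = e w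
      · obtain ⟨w, rfl⟩ := hz
        refine (hT.finite a.support a.isPWO_support w).subset ?_
        rintro _ ⟨α, hα, rfl⟩
        obtain ⟨g, hga, hg⟩ := P.exists_of_mem_support_embed α.2
        have h1 : r α.1 = g := by rw [hg]; exact hr g
        have h2 : e w ∈ (c α.1).support := right_ne_zero_of_mul (a := (P.embed n a).coeff α.1) hα
        obtain ⟨w', hw, hw'⟩ := P.exists_of_mem_support_embed h2
        obtain rfl := he hw'
        rw [← h1] at hga
        exact ⟨hga, hw⟩
      · convert Set.finite_empty
        refine Set.eq_empty_of_forall_notMem ?_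
        rintro _ ⟨α, hα, rfl⟩
        have h2 : z ∈ (c α.1).support := right_ne_zero_of_mul (a := (P.embed n a).coeff α.1) hα
        obtain ⟨w, -, hw⟩ := P.exists_of_mem_support_embed h2
        exact hz ⟨w, hw⟩
    · intro α _ β _ h
      obtain ⟨g, -, hg⟩ := P.exists_of_mem_support_embed α.2
      obtain ⟨g', -, hg'⟩ := P.exists_of_mem_support_embed β.2
      apply Subtype.ext
      replace h : r α.1 = r β.1 := h
      rw [hg, hg'] at h ⊢
      rw [(hr g).symm.trans (h.trans (hr g'))]
  · rw [T.glue_embedEL]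
    rfl
  · rw [T.glue_embedEL]
    ext z
    refine (finsum_support_mul (P.embed n a) fun y => (c y).coeff z).trans ?_
    refine (finsum_map_coeff_mul (P.toHull n) hmono a fun y => (c y).coeff z).trans ?_
    refine Eq.trans ?_ (congrArg (fun b => (P.embed n b).coeff z)
      ((T.stronglyLinear n).eq_strongSum a)).symm
    refine Eq.trans ?_ (coeff_map_strongSum (P.toHull n) hmono hT a z).symm
    refine finsum_congr fun g => ?_
    change _ * (P.embed n (T.D n (single (r (e g)) 1))).coeff z = _
    rw [hr]
    rfl

end DerTower

end Glue

/-! ### Uniqueness of the extension. -/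

section Uniqueness

variable {P : PreLogField.{u}} {d : Der P.K} {D D' : Der P.EL}

/-- The logarithm of a monomial of stage `n + 1` lies in stage `n`, so its derivative is governed by
the previous stage. This drives the induction for uniqueness. -/
theorem LogCompatible.eq_on_mon (hD : LogCompatible P.EL.subtype P.logEL D) (n : ℕ)
    (g : (P.stage (n + 1)).Γ) : D (P.embedEL (n + 1) (mon g)) =
      D (P.embedEL n (ofLex (Subtype.val (p := (· ∈ purelyInfinite (P.stage n).Γ)) g))) *
        P.embedEL (n + 1) (mon g) := by
  have h1 : Pos (P.EL.subtype (P.embedEL (n + 1) (mon g))) := by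
    refine (P.pos_embed _ _).2 ?_
    have : (mon g).leadingCoeff = 1 := leadingCoeff_of_single
    rw [Pos, this]
    exact one_pos
  have h2 := hD _ h1
  rw [P.logEL_embedEL, PreLogField.log_mon] at h2
  have h3 : (P.stage (n + 1)).sec g = (P.stage n).toSharp
    (ofLex (Subtype.val (p := (· ∈ purelyInfinite (P.stage n).Γ)) g)) := rfl
  rw [h3, P.embedEL_toSharp] at h2
  rw [h2, div_mul_cancel₀]
  exact (map_ne_zero _).2 (mon_ne_zero g)

theorem IsELExtension.unique (h : IsELExtension P d D) (h' : IsELExtension P d D') : D = D' := by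
  have key (n : ℕ) : ∀ a, D (P.embedEL n a) = D' (P.embedEL n a) := by
    induction n with
    | zero => exact fun a => (h.extends_d a).trans (h'.extends_d a).symm
    | succ n ih =>
      intro a
      obtain ⟨m, hm, s, hs, hsum⟩ := h.stronglyLinear (P.embedEL (n + 1) a)
      obtain ⟨m', hm', s', hs', hsum'⟩ := h'.stronglyLinear (P.embedEL (n + 1) a)
      apply P.EL.subtype.injective
      rw [← hsum, ← hsum']
      congr 1
      refine SummableFamily.ext fun α => ?_
      obtain ⟨g, -, hg⟩ := P.exists_of_mem_support_embed α.2
      have h1 : P.EL.subtype (P.embedEL (n + 1) (mon (ofDual g))) = mon (ofDual α.1) := by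
        rw [hg]
        exact P.embed_mon (n + 1) (ofDual g)
      have h2 : m α = P.embedEL (n + 1) (mon (ofDual g)) :=
        P.EL.subtype.injective ((hm α).trans h1.symm)
      have h3 : m' α = P.embedEL (n + 1) (mon (ofDual g)) :=
        P.EL.subtype.injective ((hm' α).trans h1.symm)
      rw [hs, hs', h2, h3, h.logCompatible.eq_on_mon, h'.logCompatible.eq_on_mon, ih]
  ext x
  obtain ⟨n, a, rfl⟩ := P.exists_embedEL x
  rw [key]

end Uniqueness

/-! ### Existence of the extension, by iterating the step to `K^♯`. -/

section Existence

variable {P : PreLogField.{u}}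

/-- A strongly linear and log-compatible derivation on a field with (GA). -/
structure GoodDer (Q : PreLogField.{u}) where
  growth : Q.GrowthAxiom
  d : Der Q.K
  stronglyLinear : StronglyLinear (RingHom.id Q.K) d
  logCompatible : LogCompatible (RingHom.id Q.K) Q.log d

/-- The extension to `K^♯`. -/
noncomputable def GoodDer.sharp {Q : PreLogField.{u}} (G : GoodDer Q) : GoodDer Q.sharp where
  growth := G.growth.sharp
  d := sharpDer G.growth G.stronglyLinear
  stronglyLinear := stronglyLinear_sharpDer G.growth G.stronglyLinear
  logCompatible := logCompatible_sharpDer G.growth G.stronglyLinear G.logCompatible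

/-- The iterated extensions to the `K^{♯n}`. -/
noncomputable def GoodDer.stage (G : GoodDer P) : ∀ n, GoodDer (P.stage n)
  | 0 => G
  | n + 1 => (G.stage n).sharp

/-- The tower of iterated extensions. -/
noncomputable def GoodDer.tower (G : GoodDer P) : DerTower P where
  D n := (G.stage n).d
  stronglyLinear n := (G.stage n).stronglyLinear
  logCompatible n := (G.stage n).logCompatible
  D_toSharp n := sharpDer_toSharp (G.stage n).growth (G.stage n).stronglyLinear
    (G.stage n).logCompatible

theorem GoodDer.isELExtension (G : GoodDer P) : IsELExtension P G.d G.tower.glue where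
  extends_d a := G.tower.glue_embedEL 0 a
  stronglyLinear := G.tower.stronglyLinear_glue
  logCompatible := G.tower.logCompatible_glue

end Existence


/-! ### Dominance, leading monomials and archimedean classes under embeddings. -/

section Dominance

variable {Γ : Type u} [AddCommGroup Γ] [LinearOrder Γ] [IsOrderedAddMonoid Γ]
  {Γ' : Type v} [AddCommGroup Γ'] [LinearOrder Γ'] [IsOrderedAddMonoid Γ']
  (f : Γ →+ Γ') (hf : StrictMono f)

theorem dom_map_iff (a b : Series Γ) : Dom (map f hf a) (map f hf b) ↔ Dom a b := by
  unfold Dom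
  rw [map_orderTop, map_orderTop]
  exact WithTop.map_le_iff _ (dualHom_le_iff f hf _ _)

theorem asymp_iff_dom (a b : Series Γ) : Asymp a b ↔ Dom a b ∧ Dom b a :=
  ⟨fun h => ⟨h.ge, h.le⟩, fun h => le_antisymm h.2 h.1⟩

theorem asymp_map_iff (a b : Series Γ) : Asymp (map f hf a) (map f hf b) ↔ Asymp a b := by
  rw [asymp_iff_dom, asymp_iff_dom, dom_map_iff, dom_map_iff]

theorem asymp_one_iff {a : Series Γ} (ha : a ≠ 0) : Asymp a 1 ↔ LM a = 0 := by
  rw [Asymp, orderTop_one, ← order_eq_orderTop_of_ne_zero ha, WithTop.coe_eq_zero]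
  exact Iff.rfl

theorem LM_map (a : Series Γ) : LM (map f hf a) = f (LM a) := map_order f hf a

theorem archimedeanClass_mk_map_eq_iff {M N : Type*} [AddCommGroup M] [LinearOrder M]
    [IsOrderedAddMonoid M] [AddCommGroup N] [LinearOrder N] [IsOrderedAddMonoid N]
    (f : M →+ N) (hf : StrictMono f) (x y : M) :
    ArchimedeanClass.mk (f x) = ArchimedeanClass.mk (f y) ↔
      ArchimedeanClass.mk x = ArchimedeanClass.mk y := by
  let F : M →+o N := ⟨f, hf.monotone⟩
  exact (ArchimedeanClass.orderHom_injective (f := F) hf.injective).eq_iff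
    (a := ArchimedeanClass.mk x) (b := ArchimedeanClass.mk y)

theorem comparable_map_iff (a b : Series Γ) :
    Comparable (map f hf a) (map f hf b) ↔ Comparable a b := by
  rw [Comparable, Comparable, LM_map, LM_map, archimedeanClass_mk_map_eq_iff f hf]

theorem orderTop_lt_iff {a b : Series Γ} (ha : a ≠ 0) (hb : b ≠ 0) :
    a.orderTop < b.orderTop ↔ LM b < LM a := by
  rw [← order_eq_orderTop_of_ne_zero ha, ← order_eq_orderTop_of_ne_zero hb, WithTop.coe_lt_coe]
  exact Iff.rfl

theorem LM_mul {a b : Series Γ} (ha : a ≠ 0) (hb : b ≠ 0) : LM (a * b) = LM a + LM b := by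
  have h := orderTop_mul a b
  rw [← order_eq_orderTop_of_ne_zero ha, ← order_eq_orderTop_of_ne_zero hb,
    ← order_eq_orderTop_of_ne_zero (mul_ne_zero ha hb), ← WithTop.coe_add, WithTop.coe_inj] at h
  exact congrArg ofDual h

theorem LM_neg {a : Series Γ} (ha : a ≠ 0) : LM (-a) = LM a := by
  have h : (-a).orderTop = a.orderTop := by rw [orderTop_neg]
  rw [← order_eq_orderTop_of_ne_zero ha, ← order_eq_orderTop_of_ne_zero (neg_ne_zero.2 ha),
    WithTop.coe_inj] at h
  exact congrArg ofDual h

theorem LM_inv {a : Series Γ} (ha : a ≠ 0) : LM a⁻¹ = -LM a := by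
  have h := LM_mul ha (inv_ne_zero ha)
  have h1 : LM (1 : Series Γ) = 0 := (asymp_one_iff one_ne_zero).1 rfl
  rw [mul_inv_cancel₀ ha, h1] at h
  exact (neg_eq_of_add_eq_zero_right h.symm).symm

theorem map_C (r : ℝ) : map f hf (C r) = C r := embDomainRingHom_C

/-- Two nonzero purely infinite series are archimedean equivalent if and only if they have the same
leading monomial. -/
theorem archimedeanClass_mk_purelyInfinite_eq_iff {a b : purelyInfinite Γ} (ha : a ≠ 0)
    (hb : b ≠ 0) : ArchimedeanClass.mk a = ArchimedeanClass.mk b ↔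
      (ofLex a.1).orderTop = (ofLex b.1).orderTop := by
  have ha' : ofLex a.1 ≠ 0 := fun h => ha (Subtype.ext h)
  have hb' : ofLex b.1 ≠ 0 := fun h => hb (Subtype.ext h)
  have h1 := archimedeanClass_mk_map_eq_iff (purelyInfinite Γ).subtype (fun _ _ h => h) a b
  rw [← h1, archimedeanClassMk_eq_archimedeanClassMk_iff]
  exact and_iff_left (ArchimedeanClass.mk_eq_mk_of_archimedean (leadingCoeff_ne_zero.2 ha')
    (leadingCoeff_ne_zero.2 hb'))

end Dominance

/-! ### Leading monomial of an infinite sum. -/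

section Leading

/-- At the leading position of `f g`, and before it in the order on `Y`, every other term has
coefficient zero, so nothing can cancel. -/
theorem orderTop_strongSum {X Y : Type*} [LinearOrder X] [LinearOrder Y] {f : X → HahnSeries Y ℝ}
    (hf : Summing f) {x : HahnSeries X ℝ} {g : X} (hg : g ∈ x.support) (hfg : f g ≠ 0)
    (h : ∀ g' ∈ x.support, g' ≠ g → (f g).orderTop < (f g').orderTop) :
    (strongSum hf x).orderTop = (f g).orderTop := by
  obtain ⟨y, hy⟩ := WithTop.ne_top_iff_exists.1 (orderTop_ne_top.2 hfg)
  have h0 (g' : X) (hne : g' ≠ g) (z : Y) (hz : z ≤ y) : x.coeff g' * (f g').coeff z = 0 := by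
    by_cases hg' : x.coeff g' = 0
    · rw [hg']
      exact zero_mul _
    · rw [coeff_eq_zero_of_lt_orderTop ((WithTop.coe_le_coe.2 hz).trans_lt
        (hy.trans_lt (h g' hg' hne))),
        mul_zero]
  rw [← hy]
  refine orderTop_eq_of_le ?_ fun z hz => ?_
  · rw [mem_support, strongSum_coeff, finsum_eq_single _ g fun g' hne => h0 g' hne y le_rfl]
    exact mul_ne_zero hg (coeff_orderTop_ne hy.symm)
  · by_contra hlt
    refine hz ?_
    rw [strongSum_coeff, finsum_eq_single _ g fun g' hne => h0 g' hne z (not_le.1 hlt).le,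
      coeff_eq_zero_of_lt_orderTop ((WithTop.coe_lt_coe.2 (not_le.1 hlt)).trans_eq hy), mul_zero]

end Leading

/-! ### The Hardy type property passes from `K` to `K^♯`. -/

section HardyStep

variable {P : PreLogField.{u}} {d : Der P.K}


theorem IsHardyType.orderTop_le_iff (hH : IsHardyType (RingHom.id P.K) d) {a b : P.K} (ha : a ≠ 0)
    (hb : b ≠ 0) (ha1 : LM a ≠ 0) (hb1 : LM b ≠ 0) :
    (d a).orderTop ≤ (d b).orderTop ↔ a.orderTop ≤ b.orderTop :=
  (hH.lHospital b a hb ha (fun h => hb1 ((asymp_one_iff hb).1 h))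
    (fun h => ha1 ((asymp_one_iff ha).1 h))).symm

theorem LM_pos_of_purelyInfinite {Γ : Type u} [AddCommGroup Γ] [LinearOrder Γ]
    [IsOrderedAddMonoid Γ] {a : purelyInfinite Γ} (ha : a ≠ 0) : 0 < LM (ofLex a.1) := by
  have ha' : ofLex a.1 ≠ 0 := fun h => ha (Subtype.ext h)
  exact a.2 _ (coeff_orderTop_ne (order_eq_orderTop_of_ne_zero ha').symm)

theorem IsHardyType.d_ne_zero (hH : IsHardyType (RingHom.id P.K) d) {a : purelyInfinite P.Γ}
    (ha : a ≠ 0) : d (ofLex a.1) ≠ 0 := by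
  intro h
  have h1 : ofLex a.1 ∈ Set.range (C : ℝ → P.K) := by
    rw [← hH.constants]
    exact ⟨_, h, rfl⟩
  obtain ⟨r, hr⟩ := h1
  have h2 := LM_pos_of_purelyInfinite ha
  rw [← hr, LM, order_C] at h2
  exact lt_irrefl _ h2

/-- By l'Hospital's rule for `x`, `y` and for `1/x`, `1/y`: if `1 ≺ y ≺ x`, then
`x' ≺ y' x²`. -/
theorem IsHardyType.LM_d_lt (hH : IsHardyType (RingHom.id P.K) d) {x y : P.K} (hx : x ≠ 0)
    (hy : y ≠ 0) (hdx : d x ≠ 0) (hdy : d y ≠ 0) (hyp : 0 < LM y) (hxy : LM y < LM x) :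
    LM (d x) < LM (d y) + (LM x + LM x) := by
  have hx0 := inv_ne_zero hx
  have hy0 := inv_ne_zero hy
  have hdinv {z : P.K} (hz : z ≠ 0) (hdz : d z ≠ 0) :
      d z⁻¹ ≠ 0 ∧ LM (d z⁻¹) = -LM z + -LM z + LM (d z) := by
    have h0 := inv_ne_zero hz
    rw [Der.map_inv, LM_neg (mul_ne_zero (pow_ne_zero _ h0) hdz), LM_mul (pow_ne_zero _ h0) hdz,
      pow_two, LM_mul h0 h0, LM_inv hz]
    exact ⟨neg_ne_zero.2 (mul_ne_zero (mul_ne_zero h0 h0) hdz), rfl⟩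
  -- The rule applied to `1/x ≺ 1/y` gives `x'/x² ≺ y'/y²`; the factor `1/y² ≺ 1` is then dropped.
  have h2 : LM (d x⁻¹) < LM (d y⁻¹) := by
    rw [← orderTop_lt_iff (hdinv hy hdy).1 (hdinv hx hdx).1, ← not_le,
      hH.orderTop_le_iff hx0 hy0 (by rw [LM_inv hx]; exact neg_ne_zero.2 (hyp.trans hxy).ne')
        (by rw [LM_inv hy]; exact neg_ne_zero.2 hyp.ne'), not_le, orderTop_lt_iff hy0 hx0,
      LM_inv hx, LM_inv hy]
    exact neg_lt_neg hxy
  rw [(hdinv hx hdx).2, (hdinv hy hdy).2] at h2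
  calc LM (d x) = (-LM x + -LM x + LM (d x)) + (LM x + LM x) := by abel
    _ < (-LM y + -LM y + LM (d y)) + (LM x + LM x) := by gcongr
    _ = LM (d y) + (LM x + LM x) - (LM y + LM y) := by abel
    _ ≤ _ := sub_le_self _ (add_pos hyp hyp).le

theorem IsHardyType.LM_lt_of_LM_d_lt (hH : IsHardyType (RingHom.id P.K) d)
    {a b : purelyInfinite P.Γ} (ha : a ≠ 0) (hb : b ≠ 0)
    (h : LM (d (ofLex b.1)) < LM (d (ofLex a.1))) : LM (ofLex b.1) < LM (ofLex a.1) := by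
  have hx : ofLex a.1 ≠ 0 := fun h => ha (Subtype.ext h)
  have hy : ofLex b.1 ≠ 0 := fun h => hb (Subtype.ext h)
  rw [← orderTop_lt_iff hx hy, ← not_le, ← hH.orderTop_le_iff hy hx
    (LM_pos_of_purelyInfinite hb).ne' (LM_pos_of_purelyInfinite ha).ne', not_le,
    orderTop_lt_iff (hH.d_ne_zero ha) (hH.d_ne_zero hb)]
  exact h

/-- If `a < b` are purely infinite and `b ≺ a`, then `l(α²) < b - a` for the leading monomial `α`
of `a`. -/
theorem PreLogField.GrowthAxiom.l_two_LM_lt (hGA : P.GrowthAxiom) {a b : purelyInfinite P.Γ}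
    (ha : a ≠ 0) (hb : b ≠ 0) (hab : a < b) (h : LM (ofLex b.1) < LM (ofLex a.1)) :
    P.l (LM (ofLex a.1) + LM (ofLex a.1)) < b - a := by
  have hx : ofLex a.1 ≠ 0 := fun h => ha (Subtype.ext h)
  have hy : ofLex b.1 ≠ 0 := fun h => hb (Subtype.ext h)
  have hxp := LM_pos_of_purelyInfinite ha
  -- If `b - a ≤ l(α²)`, then `α ≍ a ≍ b - a ≼ l(α²)`, and `two_nsmul_lt` with `δ = α²` yields `α² ≺
  -- α²`.
  by_contra hle
  have h6 := orderTop_le_of_le_purelyInfinite (sub_pos.2 hab).le (not_lt.1 hle)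
  have h7 : (ofLex (b - a).1).orderTop = (ofLex a.1).orderTop := by
    change (ofLex b.1 - ofLex a.1).orderTop = _
    rw [← neg_sub, orderTop_neg, orderTop_sub ((orderTop_lt_iff hx hy).2 h)]
  rw [h7, ← order_eq_orderTop_of_ne_zero hx] at h6
  exact lt_irrefl _ (hGA.two_nsmul_lt hxp (add_pos hxp hxp) h6)

/-- For purely infinite nonzero `a < b`, `(e^a)' ≺ (e^b)'`. -/
theorem IsHardyType.l_LM_add_lt (hH : IsHardyType (RingHom.id P.K) d) (hGA : P.GrowthAxiom)
    {a b : purelyInfinite P.Γ} (ha : a ≠ 0) (hb : b ≠ 0) (hab : a < b) :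
    P.l (LM (d (ofLex a.1))) + a < P.l (LM (d (ofLex b.1))) + b := by
  rcases le_or_gt (LM (d (ofLex a.1))) (LM (d (ofLex b.1))) with hle | hlt
  · exact add_lt_add_of_le_of_lt (P.strictMono.monotone hle) hab
  -- The remaining case is `a' ≻ b'`, where `a ≻ b`. With `α` the leading monomial of `a`, the loss
  -- `a'/b'` is `≺ α²`, while the gain `e^{b-a}` is `≻ α²`.
  have hLM := hH.LM_lt_of_LM_d_lt ha hb hlt
  have h1 := P.strictMono (hH.LM_d_lt (x := ofLex a.1) (y := ofLex b.1) (fun h => ha (Subtype.ext h))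
    (fun h => hb (Subtype.ext h)) (hH.d_ne_zero ha) (hH.d_ne_zero hb) (LM_pos_of_purelyInfinite hb) hLM)
  have h2 := hGA.l_two_LM_lt ha hb hab hLM
  rw [map_add] at h1
  calc P.l (LM (d (ofLex a.1))) + a
      < P.l (LM (d (ofLex b.1))) + P.l (LM (ofLex a.1) + LM (ofLex a.1)) + a :=
        add_lt_add_left h1 a
    _ < P.l (LM (d (ofLex b.1))) + (b - a) + a := add_lt_add_left (add_lt_add_right h2 _) a
    _ = P.l (LM (d (ofLex b.1))) + b := by abel

theorem orderTop_expDer {a : purelyInfinite P.Γ} (h : d (ofLex a.1) ≠ 0) :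
    (expDer P d (toDual a)).orderTop =
      (toDual (P.l (LM (d (ofLex a.1))) + a) : (purelyInfinite P.Γ)ᵒᵈ) := by
  rw [expDer, orderTop_mul, orderTop_single one_ne_zero, map_orderTop, ofDual_toDual,
    ← order_eq_orderTop_of_ne_zero h]
  rfl

theorem expDer_zero : expDer P d 0 = 0 := by
  have : d (ofLex (ofDual (0 : (purelyInfinite P.Γ)ᵒᵈ)).1) = 0 := Der.map_zero d
  rw [expDer, this, RingHom.map_zero]
  exact zero_mul _

theorem IsHardyType.expDer_orderTop_lt (hH : IsHardyType (RingHom.id P.K) d) (hGA : P.GrowthAxiom)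
    {x y : (purelyInfinite P.Γ)ᵒᵈ} (hx : x ≠ 0) (hxy : x < y) :
    (expDer P d x).orderTop < (expDer P d y).orderTop := by
  have hdx := hH.d_ne_zero (a := ofDual x) hx
  have h1 := orderTop_expDer hdx
  rw [toDual_ofDual] at h1
  rw [h1]
  -- The index `0` is the monomial `1`, whose derivative vanishes and so has order `⊤`.
  by_cases hy : y = 0
  · rw [hy, expDer_zero, orderTop_zero]
    exact WithTop.coe_lt_top _
  · have h2 := orderTop_expDer (hH.d_ne_zero (a := ofDual y) hy)
    rw [toDual_ofDual] at h2
    rw [h2, WithTop.coe_lt_coe]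
    exact hH.l_LM_add_lt hGA hy hx hxy

variable (hGA : P.GrowthAxiom) (hd : StronglyLinear (RingHom.id P.K) d)

theorem IsHardyType.orderTop_strongSum_expDer (hH : IsHardyType (RingHom.id P.K) d)
    {x : Series (purelyInfinite P.Γ)} (hx : x ≠ 0) (hx1 : LM x ≠ 0) :
    (strongSum (summing_expDer hGA hd) x).orderTop = (expDer P d x.order).orderTop := by
  have ho := order_eq_orderTop_of_ne_zero hx
  refine orderTop_strongSum _ (coeff_orderTop_ne ho.symm) ?_ fun g hg hne => ?_
  · rw [← orderTop_ne_top]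
    exact ((orderTop_expDer (hH.d_ne_zero (a := LM x) hx1)).trans_ne WithTop.coe_ne_top)
  · refine hH.expDer_orderTop_lt hGA hx1 (lt_of_le_of_ne ?_ hne.symm)
    rw [← WithTop.coe_le_coe, ho]
    exact orderTop_le_of_coeff_ne_zero hg

/-- Writing the leading monomial of `x` as `e^a`, this is `x'/x ≍ (e^a)'/e^a = a'`: logarithmic
derivatives in `K^♯` become derivatives in `K`. -/
theorem IsHardyType.orderTop_strongSum_div (hH : IsHardyType (RingHom.id P.K) d)
    {x : Series (purelyInfinite P.Γ)} (hx : x ≠ 0) (hx1 : LM x ≠ 0) :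
    (strongSum (summing_expDer hGA hd) x / x).orderTop =
      (map P.l P.strictMono (d (ofLex (LM x).1))).orderTop := by
  have h1 := hH.orderTop_strongSum_expDer hGA hd hx hx1
  have ho := order_eq_orderTop_of_ne_zero hx
  rw [← div_mul_cancel₀ (strongSum (summing_expDer hGA hd) x) hx, orderTop_mul, expDer,
    orderTop_mul, orderTop_single one_ne_zero, ← ho] at h1
  exact WithTop.add_right_cancel WithTop.coe_ne_top h1

theorem IsHardyType.sharp (hH : IsHardyType (RingHom.id P.K) d) :
    IsHardyType (RingHom.id P.sharp.K) (sharpDer hGA hd) := by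
  have hf := summing_expDer hGA hd
  have hC (r : ℝ) : strongSum hf (C r) = 0 := by
    rw [C_apply, strongSum_single, expDer_zero, smul_zero]
  refine ⟨?_, fun a b ha hb ha1 hb1 => ?_, fun a b ha hb hb1 hab => ?_⟩
  · ext x
    change Series (purelyInfinite P.Γ) at x
    constructor
    · rintro ⟨x, hx, rfl⟩
      change Series (purelyInfinite P.Γ) at x
      replace hx : strongSum hf x = 0 := hx
      refine ⟨x.coeff 0, ?_⟩
      change C (x.coeff 0) = x
      by_contra hne
      -- Removing the constant term leaves a series whose leading monomial is not `1`; were it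
      -- nonzero, its derivative would be nonzero too.
      have h1 : x - C (x.coeff 0) ≠ 0 := sub_ne_zero.2 (Ne.symm hne)
      have h2 : LM (x - C (x.coeff 0)) ≠ 0 := by
        intro h
        have h3 := coeff_orderTop_ne (order_eq_orderTop_of_ne_zero h1).symm
        have h4 : (x - C (x.coeff 0)).order = 0 := h
        rw [h4] at h3
        simp at h3
      have h3 := hH.orderTop_strongSum_expDer hGA hd h1 h2
      rw [AddMonoidHom.map_sub, hx, hC, sub_zero, orderTop_zero] at h3
      exact ((orderTop_expDer (hH.d_ne_zero (a := LM (x - C (x.coeff 0))) h2)).trans_ne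
        WithTop.coe_ne_top) h3.symm
    · rintro ⟨r, rfl⟩
      exact ⟨C r, hC r, rfl⟩
  · change Series (purelyInfinite P.Γ) at a b
    change b.orderTop ≤ a.orderTop ↔ (strongSum hf b).orderTop ≤ (strongSum hf a).orderTop
    replace ha1 : LM a ≠ 0 := fun h => ha1 ((asymp_one_iff ha).2 h)
    replace hb1 : LM b ≠ 0 := fun h => hb1 ((asymp_one_iff hb).2 h)
    rw [hH.orderTop_strongSum_expDer hGA hd ha ha1, hH.orderTop_strongSum_expDer hGA hd hb hb1,
      ← order_eq_orderTop_of_ne_zero ha, ← order_eq_orderTop_of_ne_zero hb, WithTop.coe_le_coe]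
    constructor
    · intro h
      rcases h.eq_or_lt with h | h
      · rw [h]
      · exact (hH.expDer_orderTop_lt hGA hb1 h).le
    · intro h
      by_contra hlt
      exact absurd h (not_le.2 (hH.expDer_orderTop_lt hGA ha1 (not_le.1 hlt)))
  · change Series (purelyInfinite P.Γ) at a b
    replace ha : a ≠ 0 := ha
    replace hb : b ≠ 0 := hb
    replace hb1 : 0 < |LM b| := hb1
    replace hab : |LM b| < |LM a| := hab
    change Dom (strongSum hf b / b) (strongSum hf a / a) ∧
      (Asymp (strongSum hf a / a) (strongSum hf b / b) ↔ Comparable a b)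
    have hb0 : LM b ≠ 0 := abs_pos.1 hb1
    have ha0 : LM a ≠ 0 := abs_pos.1 (hb1.trans hab)
    -- The leading monomials are `e^p` and `e^q` with `p`, `q` purely infinite, so `|e^q| ≺ |e^p|`
    -- means `|q| < |p|`, whence `q ≼ p`. By l'Hospital's rule in `K` this gives `q' ≼ p'`, and
    -- comparability of `e^p` and `e^q` amounts to `p ≍ q`, that is, to `p' ≍ q'`.
    have hle : (ofLex (LM a).1).orderTop ≤ (ofLex (LM b).1).orderTop := by
      by_contra h
      have h1 := abs_lt_abs_of_orderTop_ofLex (not_le.1 h)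
      exact lt_asymm hab h1
    have hiff {x y : purelyInfinite P.Γ} (hx : x ≠ 0) (hy : y ≠ 0) :=
      hH.orderTop_le_iff (a := ofLex x.1) (b := ofLex y.1) (fun h => hx (Subtype.ext h))
        (fun h => hy (Subtype.ext h))
        (LM_pos_of_purelyInfinite hx).ne' (LM_pos_of_purelyInfinite hy).ne'
    have key : Dom (strongSum hf b / b) (strongSum hf a / a) ↔
        Dom (d (ofLex (LM b).1)) (d (ofLex (LM a).1)) := by
      rw [← dom_map_iff P.l P.strictMono, Dom, hH.orderTop_strongSum_div hGA hd ha ha0,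
        hH.orderTop_strongSum_div hGA hd hb hb0, Dom]
    have key' : Dom (strongSum hf a / a) (strongSum hf b / b) ↔
        Dom (d (ofLex (LM a).1)) (d (ofLex (LM b).1)) := by
      rw [← dom_map_iff P.l P.strictMono, Dom, hH.orderTop_strongSum_div hGA hd ha ha0,
        hH.orderTop_strongSum_div hGA hd hb hb0, Dom]
    rw [asymp_iff_dom, key, key', Comparable, archimedeanClass_mk_purelyInfinite_eq_iff ha0 hb0]
    unfold Dom
    rw [hiff ha0 hb0, hiff hb0 ha0]
    exact ⟨hle, fun h => le_antisymm h.2 h.1, fun h => ⟨h.ge, h.le⟩⟩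

end HardyStep

/-! ### The Hardy type property on `K^EL`. -/

section HardyEL

variable {P : PreLogField.{u}}

theorem GoodDer.isHardyType_stage (G : GoodDer P) (hH : IsHardyType (RingHom.id P.K) G.d) :
    ∀ n, IsHardyType (RingHom.id (P.stage n).K) (G.stage n).d
  | 0 => hH
  | n + 1 => (G.isHardyType_stage hH n).sharp (G.stage n).growth (G.stage n).stronglyLinear

/-- Each condition involves at most two elements, which lie in a common stage, and the embeddings of
the stages preserve and reflect dominance, comparability and real constants. -/
theorem DerTower.isHardyType_glue (T : DerTower P)
    (hT : ∀ n, IsHardyType (RingHom.id (P.stage n).K) (T.D n)) :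
    IsHardyType P.EL.subtype T.glue := by
  have hdom (n : ℕ) (a b : (P.stage n).K) :
      Dom (P.EL.subtype (P.embedEL n a)) (P.EL.subtype (P.embedEL n b)) ↔ Dom a b :=
    dom_map_iff (P.toHull n) (P.toHull_strictMono n) a b
  have hasymp (n : ℕ) (a b : (P.stage n).K) :
      Asymp (P.EL.subtype (P.embedEL n a)) (P.EL.subtype (P.embedEL n b)) ↔ Asymp a b :=
    asymp_map_iff (P.toHull n) (P.toHull_strictMono n) a b
  have hcomp (n : ℕ) (a b : (P.stage n).K) :
      Comparable (P.EL.subtype (P.embedEL n a)) (P.EL.subtype (P.embedEL n b)) ↔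
        Comparable a b :=
    comparable_map_iff (P.toHull n) (P.toHull_strictMono n) a b
  have hone (n : ℕ) (a : (P.stage n).K) :
      Asymp (P.EL.subtype (P.embedEL n a)) 1 ↔ Asymp a 1 := by
    rw [← hasymp, map_one, map_one]
  have hLM (n : ℕ) (a : (P.stage n).K) :
      LM (P.EL.subtype (P.embedEL n a)) = P.toHull n (LM a) :=
    LM_map (P.toHull n) (P.toHull_strictMono n) a
  have habs (n : ℕ) (x : (P.stage n).Γ) : |P.toHull n x| = P.toHull n |x| :=
    (map_abs (⟨P.toHull n, (P.toHull_strictMono n).monotone⟩ : (P.stage n).Γ →+o P.hull.Γ) x).symm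
  refine ⟨?_, fun x y hx hy hx1 hy1 => ?_, fun x y hx hy hy1 hxy => ?_⟩
  · ext x
    constructor
    · rintro ⟨x, hx, rfl⟩
      obtain ⟨n, a, rfl⟩ := P.exists_embedEL x
      replace hx : T.glue (P.embedEL n a) = 0 := hx
      rw [T.glue_embedEL, map_eq_zero] at hx
      have h1 : a ∈ Set.range (C : ℝ → (P.stage n).K) := by
        rw [← (hT n).constants]
        exact ⟨a, hx, rfl⟩
      obtain ⟨r, rfl⟩ := h1
      exact ⟨r, (map_C (P.toHull n) (P.toHull_strictMono n) r).symm⟩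
    · rintro ⟨r, rfl⟩
      refine ⟨P.embedEL 0 (C r), ?_, map_C (P.toHull 0) (P.toHull_strictMono 0) r⟩
      have h1 : (C r : (P.stage 0).K) ∈ RingHom.id _ '' {a | T.D 0 a = 0} := by
        rw [(hT 0).constants]
        exact ⟨r, rfl⟩
      obtain ⟨a, ha, ha'⟩ := h1
      have h2 : T.D 0 a = 0 := ha
      change T.glue (P.embedEL 0 (C r)) = 0
      rw [← ha', RingHom.id_apply, T.glue_embedEL, h2, map_zero]
  · obtain ⟨n, a, b, rfl, rfl⟩ := P.exists_embedEL₂ x y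
    rw [T.glue_embedEL, T.glue_embedEL, hdom, hdom]
    rw [hone] at hx1 hy1
    exact (hT n).lHospital a b ((map_ne_zero _).1 hx) ((map_ne_zero _).1 hy) hx1 hy1
  · obtain ⟨n, a, b, rfl, rfl⟩ := P.exists_embedEL₂ x y
    rw [T.glue_embedEL, T.glue_embedEL, ← map_div₀, ← map_div₀, hdom, hasymp, hcomp]
    rw [hLM, habs] at hy1
    rw [hLM, hLM, habs, habs, (P.toHull_strictMono n).lt_iff_lt] at hxy
    rw [← map_zero (P.toHull n), (P.toHull_strictMono n).lt_iff_lt] at hy1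
    exact (hT n).logDeriv a b ((map_ne_zero _).1 hx) ((map_ne_zero _).1 hy) hy1 hxy

end HardyEL

end ELSeries

theorem mainTheorem2 (P : ELSeries.PreLogField.{u}) (hGA : P.GrowthAxiom)
    (d : ELSeries.Der P.K)
    (hsl : ELSeries.StronglyLinear (RingHom.id P.K) d)
    (hlc : ELSeries.LogCompatible (RingHom.id P.K) P.log d) :
    (∃! D : ELSeries.Der P.EL, ELSeries.IsELExtension P d D) ∧
    (ELSeries.IsHardyType (RingHom.id P.K) d →
      ∀ D : ELSeries.Der P.EL, ELSeries.IsELExtension P d D →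
        ELSeries.IsHardyType P.EL.subtype D) := by
  let G : ELSeries.GoodDer P := ⟨hGA, d, hsl, hlc⟩
  refine ⟨⟨G.tower.glue, G.isELExtension, fun D hD => hD.unique G.isELExtension⟩,
    fun hH D hD => ?_⟩
  rw [hD.unique G.isELExtension]
  exact G.tower.isHardyType_glue (G.isHardyType_stage hH)
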